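/- Let $\mathbb H$ be the upper half plane and write $e(z)=e^{2\pi i z}$. Let $\widetilde G$ be the group of pairs $(\alpha,\varphi)$ with $\alpha=\begin{pmatrix}a&b\\c&d\end{pmatrix}\in GL_2^+(\mathbb R)$ and $\varphi$ holomorphic on $\mathbb H$ with $\varphi(z)^2=\varsigma\det(\alpha)^{-1/2}(cz+d)$ for some constant $|\varsigma|=1$, with the law $(\alpha,\varphi(z))(\beta,\psi(z))=(\alpha\beta,\varphi(\beta z)\psi(z))$. Fix an integer $\ell\ge 2$; for $f:\mathbb H\to\mathbb C$ and $\xi=(\alpha,\varphi)\in\widetilde G$ put $f|_{[\xi]}(z)=\varphi(z)^{-(2\ell+1)}f(\alpha z)$. All square roots are principal (argument in $(-\pi/2,\pi/2]$). For odd $d$, let $\left(\frac cd\right)$ be the Jacobi symbol $\left(\frac c{|d|}\right)$, multiplied by $-1$ if $c<0$ and $d<0$ (so $\left(\frac 0{\pm1}\right)=1$), and let $\varepsilon_d=1$ or $i$ according as $d\equiv1$ or $3\pmod 4$. For $\gamma=\begin{pmatrix}a&b\\c&d\end{pmatrix}\in\Gamma_0(4)$ let $\gamma^*=(\gamma,\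 \varepsilon_d^{-1}\left(\frac cd\right)(cz+d)^{1/2})\in\widetilde G$. For $4\mid N$, a cusp form of weight $\ell+\frac12$ for $\Gamma_0(N)$ is a holomorphic $f:\mathbb H\to\mathbb C$ such that $f|_{[\gamma^*]}=f$ for all $\gamma\in\Gamma_0(N)$ and such that, whenever $\rho\in\widetilde G$, $\eta\in\Gamma_0(N)$ and $|t|=1$ satisfy $\rho^{-1}\eta^*\rho=\left(\begin{pmatrix}1&1\\0&1\end{pmatrix},t\right)$, and $r\in[0,1)$ is determined by $e(r)=t^{2\ell+1}$, there is an expansion $f|_{[\rho]}(z)=\sum_{n\in\mathbb Z,\ n+r>0}c_n\,e((n+r)z)$ on $\mathbb H$. For a prime $p\nmid N$ the Hecke operator $T(p^2)$ is $$T(p^2)f=p^{\ell-3/2}\Big\{\sum_{0\le b<p^2}f|_{[\alpha_b^\star]}+\sum_{1\le h<p}f|_{[\beta_h^\star]}+f|_{[\sigma^\star]}\Big\},$$ where $\alpha_b^\star=\left(\begin{pmatrix}1&b\\0&p^2\end{pmatrix},p^{1/2}\right)$, $\beta_h^\star=\left(\begin{pmatrix}p&h\\0&p\end{pmatrix},\varepsilon_p^{-1}\left(\frac{-h}p\right)\right)$,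 $\sigma^\star=\left(\begin{pmatrix}p^2&0\\0&1\end{pmatrix},p^{-1/2}\right)$. An eigenform of $T(p^2)$ for $\Gamma_0(N)$ with eigenvalue $\omega\in\mathbb C$ is a nonzero cusp form $f$ of weight $\ell+\frac12$ for $\Gamma_0(N)$ with $T(p^2)f=\omega f$. **Lemma.** Let $p$ be an odd prime, and let $\mathfrak f$ be an eigenform of $T(p^2)$ of weight $\ell+\frac12$ for $\Gamma_0(4)$, with eigenvalue $\omega$. Put $$\mathfrak g=\big(\mathfrak f|_{[\rho_{-1/2}]}\big)|_{[\alpha]},\qquad \mathfrak h=\mathfrak f|_{[\rho_0]},$$ where $\rho_{-1/2}=\left(\begin{pmatrix}1&0\\-2&1\end{pmatrix},(-2z+1)^{1/2}\right)$, $\alpha=\left(\begin{pmatrix}4&0\\0&1\end{pmatrix},2^{-1/2}\right)$ and $\rho_0=\left(\begin{pmatrix}0&-1\\4&0\end{pmatrix},2^{1/2}(-iz)^{1/2}\right)$. Then $\mathfrak g$ is an eigenform of $T(p^2)$ for $\Gamma_0(16)$ with eigenvalue $\omega$, and $\mathfrak h$ is an eigenform of $T(p^2)$ for $\Gamma_0(4)$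 with eigenvalue $\omega$. -/

import Mathlib

open scoped MatrixGroups Manifold
open UpperHalfPlane

namespace HalfIntegral

noncomputable section

/-- The group `G̃` of pairs `(α, φ)` with `α ∈ GL₂⁺(ℝ)` and `φ` holomorphic on the upper half plane
such that `φ(z)² = ς det(α)^{-1/2} (c z + d)` for some constant `ς` of absolute value `1`. -/
@[ext]
structure Gt where
  mat : GL(2, ℝ)⁺
  phi : ℍ → ℂ
  holo : MDifferentiable 𝓘(ℂ) 𝓘(ℂ) phi
  sq_eq : ∃ s : ℂ, ‖s‖ = 1 ∧ ∀ z : ℍ,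
    phi z ^ 2 = s * ((√((mat : GL (Fin 2) ℝ).det : ℝ))⁻¹ : ℝ) * denom (mat : GL (Fin 2) ℝ) z

namespace Gt

lemma phi_ne_zero (x : Gt) (z : ℍ) : x.phi z ≠ 0 := by
  obtain ⟨s, hs, h⟩ := x.sq_eq
  intro h0
  have h1 := h z
  rw [h0] at h1
  have h2 : s ≠ 0 := by
    rintro rfl
    simp at hs
  have h3 : (((√((x.mat : GL (Fin 2) ℝ).det : ℝ))⁻¹ : ℝ) : ℂ) ≠ 0 := by
    have hd : 0 < ((x.mat : GL (Fin 2) ℝ).det : ℝ) := x.mat.2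
    exact_mod_cast (inv_pos.mpr (Real.sqrt_pos.mpr hd)).ne'
  have h4 := denom_ne_zero (x.mat : GL (Fin 2) ℝ) z
  apply mul_ne_zero (mul_ne_zero h2 h3) h4
  rw [← h1]
  norm_num

/-- `(α, φ(z)) (β, ψ(z)) = (α β, φ(β z) ψ(z))`. -/
instance : Mul Gt where
  mul x y :=
    { mat := x.mat * y.mat
      phi := fun z => x.phi (y.mat • z) * y.phi z
      holo := (x.holo.comp (mdifferentiable_smul (g := (y.mat : GL (Fin 2) ℝ)) y.mat.2)).mul y.holo
      sq_eq := by
        obtain ⟨s, hs, h⟩ := x.sq_eq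
        obtain ⟨t, ht, k⟩ := y.sq_eq
        refine ⟨s * t, by simp [hs, ht], fun z => ?_⟩
        have hx : 0 < ((x.mat : GL (Fin 2) ℝ).det : ℝ) := x.mat.2
        have hc := denom_cocycle_σ (x.mat : GL (Fin 2) ℝ) (y.mat : GL (Fin 2) ℝ) z
        have hσ : ∀ w : ℂ, σ (y.mat : GL (Fin 2) ℝ) w = w := by
          intro w
          have hy : 0 < ((y.mat : GL (Fin 2) ℝ).det : ℝ) := y.mat.2
          rw [σ, if_pos hy]
          rfl
        rw [hσ] at hc
        rw [mul_pow, h, k, Subgroup.coe_mul, hc, map_mul, Units.val_mul,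
          Real.sqrt_mul hx.le, mul_inv, Complex.ofReal_mul]
        change _ * denom _ ↑((y.mat : GL (Fin 2) ℝ) • z) * _ = _
        ring }

instance : One Gt where
  one :=
    { mat := 1
      phi := fun _ => 1
      holo := mdifferentiable_const
      sq_eq := ⟨1, by simp, fun z => by simp⟩ }

@[simp] lemma mul_mat (x y : Gt) : (x * y).mat = x.mat * y.mat := rfl
@[simp] lemma mul_phi (x y : Gt) (z : ℍ) : (x * y).phi z = x.phi (y.mat • z) * y.phi z := rfl
@[simp] lemma one_mat : (1 : Gt).mat = 1 := rfl
@[simp] lemma one_phi (z : ℍ) : (1 : Gt).phi z = 1 := rfl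

instance : Inv Gt where
  inv x :=
    { mat := x.mat⁻¹
      phi := fun z => (x.phi (x.mat⁻¹ • z))⁻¹
      holo := by
        have h := x.holo.comp
          (mdifferentiable_smul (g := ((x.mat⁻¹ : GL(2, ℝ)⁺) : GL (Fin 2) ℝ)) (x.mat⁻¹).2)
        rw [mdifferentiable_iff] at h ⊢
        exact h.inv fun z _ => x.phi_ne_zero _
      sq_eq := by
        obtain ⟨s, hs, h⟩ := x.sq_eq
        refine ⟨s⁻¹, by simp [hs], fun z => ?_⟩
        have hc := denom_cocycle_σ (x.mat : GL (Fin 2) ℝ) ((x.mat⁻¹ : GL(2, ℝ)⁺) : GL (Fin 2) ℝ) z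
        have hσ : ∀ w : ℂ, σ ((x.mat⁻¹ : GL(2, ℝ)⁺) : GL (Fin 2) ℝ) w = w := by
          intro w
          have hy : 0 < (((x.mat⁻¹ : GL(2, ℝ)⁺) : GL (Fin 2) ℝ).det : ℝ) := (x.mat⁻¹).2
          rw [σ, if_pos hy]
          rfl
        rw [hσ, ← Subgroup.coe_mul, mul_inv_cancel, Subgroup.coe_one, denom_one] at hc
        have hx : 0 < ((x.mat : GL (Fin 2) ℝ).det : ℝ) := x.mat.2
        have hr : (√((x.mat : GL (Fin 2) ℝ).det : ℝ) : ℂ) ≠ 0 := by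
          exact_mod_cast (Real.sqrt_pos.mpr hx).ne'
        have h4 := denom_ne_zero ((x.mat⁻¹ : GL(2, ℝ)⁺) : GL (Fin 2) ℝ) z
        have hd : denom (x.mat : GL (Fin 2) ℝ) ↑((x.mat⁻¹ : GL(2, ℝ)⁺) • z) =
            (denom ((x.mat⁻¹ : GL(2, ℝ)⁺) : GL (Fin 2) ℝ) z)⁻¹ :=
          eq_inv_of_mul_eq_one_left hc.symm
        rw [inv_pow, h, hd, Subgroup.coe_inv, map_inv, Units.val_inv_eq_inv_val, Real.sqrt_inv]
        push_cast
        simp only [mul_inv, inv_inv] }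

instance : Group Gt :=
  Group.ofLeftAxioms
    (fun x y z => by
      ext1
      · simp [mul_assoc]
      · funext w
        simp [mul_smul, mul_assoc])
    (fun x => by
      ext1
      · simp
      · funext w
        simp)
    (fun x => by
      ext1
      · exact inv_mul_cancel x.mat
      · funext w
        change (x.phi (x.mat⁻¹ • x.mat • w))⁻¹ * x.phi w = 1
        rw [inv_smul_smul]
        exact inv_mul_cancel₀ (x.phi_ne_zero w))

end Gt

/-- The slash operator of weight `ℓ + 1/2`: `f|[ξ](z) = φ(z)^{-(2ℓ+1)} f(α z)` for `ξ = (α, φ)`. -/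
def slash (l : ℕ) (x : Gt) (f : ℍ → ℂ) : ℍ → ℂ :=
  fun z => x.phi z ^ (-(2 * (l : ℤ) + 1)) * f (x.mat • z)

/-- The matrix `(a b; c d)` as an element of `GL₂⁺(ℝ)`. -/
def glPos (a b c d : ℝ) (h : 0 < a * d - b * c) : GL(2, ℝ)⁺ :=
  ⟨Matrix.GeneralLinearGroup.mkOfDetNeZero !![a, b; c, d]
    (by rw [Matrix.det_fin_two_of]; exact h.ne'), by
    rw [Matrix.mem_glpos]
    change 0 < Matrix.det !![a, b; c, d]
    rwa [Matrix.det_fin_two_of]⟩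

lemma glPos_det (a b c d : ℝ) (h : 0 < a * d - b * c) :
    (((glPos a b c d h : GL(2, ℝ)⁺) : GL (Fin 2) ℝ).det : ℝ) = a * d - b * c := by
  change Matrix.det !![a, b; c, d] = _
  rw [Matrix.det_fin_two_of]

lemma glPos_denom (a b c d : ℝ) (h : 0 < a * d - b * c) (z : ℂ) :
    denom ((glPos a b c d h : GL(2, ℝ)⁺) : GL (Fin 2) ℝ) z = c * z + d := by
  simp [denom, glPos, Matrix.GeneralLinearGroup.mkOfDetNeZero]

/-- The element `((a b; 0 d), k)` of `G̃`, with a constant function `k`. -/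
def upper (a b d : ℝ) (k : ℂ) (ha : 0 < a) (hd : 0 < d) (hk : ‖k‖ ^ 2 * √(a * d) = d) : Gt where
  mat := glPos a b 0 d (by simpa using mul_pos ha hd)
  phi := fun _ => k
  holo := mdifferentiable_const
  sq_eq := by
    have hs : 0 < √(a * d) := Real.sqrt_pos.mpr (mul_pos ha hd)
    have hs' : (√(a * d) : ℂ) ≠ 0 := by exact_mod_cast hs.ne'
    have hd' : (d : ℂ) ≠ 0 := by exact_mod_cast hd.ne'
    refine ⟨k ^ 2 * √(a * d) / d, ?_, fun z => ?_⟩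
    · rw [norm_div, norm_mul, norm_pow, Complex.norm_of_nonneg hs.le,
        Complex.norm_of_nonneg hd.le, hk, div_self hd.ne']
    · rw [glPos_det, glPos_denom]
      push_cast
      rw [mul_zero, sub_zero]
      field_simp
      simp

/-- The extended quadratic residue symbol `(c/d)` for integers `c` and odd `d`: the Jacobi symbol
`(c/|d|)`, with the sign changed when both `c` and `d` are negative; in particular
`(0/±1) = 1`, and `(c/d) = 0` if `c` and `d` are not coprime. -/
def extSym (c d : ℤ) : ℤ :=
  if c < 0 ∧ d < 0 then -jacobiSym c d.natAbs else jacobiSym c d.natAbs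

lemma extSym_sq (c d : ℤ) (h : IsCoprime c d) : extSym c d ^ 2 = 1 := by
  have h1 : jacobiSym c d.natAbs ^ 2 = 1 := by
    apply jacobiSym.sq_one
    rw [Int.isCoprime_iff_gcd_eq_one] at h
    exact h
  unfold extSym
  split_ifs
  · rw [neg_sq, h1]
  · exact h1

/-- `ε_d = 1` if `d ≡ 1 (mod 4)` and `ε_d = i` if `d ≡ 3 (mod 4)` (only odd `d` matter). -/
def eps (d : ℤ) : ℂ := if d % 4 = 1 then 1 else Complex.I

lemma norm_eps (d : ℤ) : ‖eps d‖ = 1 := by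
  unfold eps
  split_ifs <;> simp

lemma mdiff_cpow_half {u : ℍ → ℂ} (hu : MDifferentiable 𝓘(ℂ) 𝓘(ℂ) u)
    (h : ∀ z, u z ∈ Complex.slitPlane) :
    MDifferentiable 𝓘(ℂ) 𝓘(ℂ) (fun z => u z ^ (1 / 2 : ℂ)) := by
  rw [mdifferentiable_iff] at hu ⊢
  exact hu.cpow_const fun z _ => h _

lemma mdiff_linear (c d : ℂ) : MDifferentiable 𝓘(ℂ) 𝓘(ℂ) (fun z : ℍ => c * (z : ℂ) + d) :=
  (mdifferentiable_const.mul mdifferentiable_coe).add mdifferentiable_const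

lemma cpow_half_sq (w : ℂ) : (w ^ (1 / 2 : ℂ)) ^ 2 = w := by
  rw [← Complex.cpow_nat_mul]
  norm_num

lemma mdiff_sqrt_linear (c d : ℝ) :
    MDifferentiable 𝓘(ℂ) 𝓘(ℂ) (fun z : ℍ => ((c : ℂ) * (z : ℂ) + (d : ℂ)) ^ (1 / 2 : ℂ)) := by
  by_cases hc : c = 0
  · subst hc
    simpa using mdifferentiable_const
  · apply mdiff_cpow_half (mdiff_linear _ _)
    intro z
    right
    simpa using ⟨hc, z.im_ne_zero⟩

/-- The automorphy factor `j(γ, z) = ε_d⁻¹ (c/d) (c z + d)^{1/2}`, with the principal branch of the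
square root (argument in `(-π/2, π/2]`). -/
def jFactor (g : SL(2, ℤ)) (z : ℍ) : ℂ :=
  (eps (g 1 1))⁻¹ * (extSym (g 1 0) (g 1 1) : ℂ) *
    (((g 1 0 : ℤ) : ℂ) * (z : ℂ) + ((g 1 1 : ℤ) : ℂ)) ^ (1 / 2 : ℂ)

lemma det_pos_of_SL (g : SL(2, ℤ)) :
    (0 : ℝ) < ((g 0 0 : ℤ) : ℝ) * ((g 1 1 : ℤ) : ℝ) - ((g 0 1 : ℤ) : ℝ) * ((g 1 0 : ℤ) : ℝ) := by
  have hd := g.det_coe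
  rw [Matrix.det_fin_two] at hd
  have : (g 0 0 : ℤ) * g 1 1 - g 0 1 * g 1 0 > 0 := by linarith
  exact_mod_cast this

/-- The lift `γ ↦ γ* = (γ, j(γ, z))` from `Γ₀(4)` to `G̃`. -/
def lift (g : CongruenceSubgroup.Gamma0 4) : Gt where
  mat := glPos ((g : SL(2, ℤ)) 0 0 : ℤ) ((g : SL(2, ℤ)) 0 1 : ℤ) ((g : SL(2, ℤ)) 1 0 : ℤ)
    ((g : SL(2, ℤ)) 1 1 : ℤ) (det_pos_of_SL g)
  phi := jFactor g
  holo := by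
    have h := mdiff_sqrt_linear (((g : SL(2, ℤ)) 1 0 : ℤ) : ℝ) (((g : SL(2, ℤ)) 1 1 : ℤ) : ℝ)
    push_cast at h
    exact mdifferentiable_const.mul h
  sq_eq := by
    have hcop : IsCoprime ((g : SL(2, ℤ)) 1 0) ((g : SL(2, ℤ)) 1 1) := by
      have hd := (g : SL(2, ℤ)).det_coe
      rw [Matrix.det_fin_two] at hd
      exact ⟨-(g : SL(2, ℤ)) 0 1, (g : SL(2, ℤ)) 0 0, by linarith⟩
    refine ⟨((eps ((g : SL(2, ℤ)) 1 1))⁻¹) ^ 2, by simp [norm_eps], fun z => ?_⟩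
    have h2 : ((extSym ((g : SL(2, ℤ)) 1 0) ((g : SL(2, ℤ)) 1 1) : ℤ) : ℂ) ^ 2 = 1 := by
      exact_mod_cast extSym_sq _ _ hcop
    have hdet : (((g : SL(2, ℤ)) 0 0 : ℤ) : ℝ) * (((g : SL(2, ℤ)) 1 1 : ℤ) : ℝ)
        - (((g : SL(2, ℤ)) 0 1 : ℤ) : ℝ) * (((g : SL(2, ℤ)) 1 0 : ℤ) : ℝ) = 1 := by
      have hd := (g : SL(2, ℤ)).det_coe
      rw [Matrix.det_fin_two] at hd
      exact_mod_cast hd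
    rw [jFactor, mul_pow, mul_pow, h2, cpow_half_sq, glPos_det, glPos_denom, hdet]
    simp

/-- The element `((1 1; 0 1), t)` of `G̃`, `|t| = 1`. -/
def translation (t : Circle) : Gt :=
  upper 1 1 1 t one_pos one_pos (by rw [Circle.norm_coe]; simp)

/-- Holomorphic cusp forms of weight `ℓ + 1/2` for `Γ₀(N)`, where `4 ∣ N`:
* `f` is holomorphic on the upper half plane and `f|[γ*] = f` for all `γ ∈ Γ₀(N)`;
* `f` vanishes at every cusp: whenever `ρ ∈ G̃` and `η ∈ Γ₀(N)` satisfy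
  `ρ⁻¹ η* ρ = ((1 1; 0 1), t)` (so that `ρ(∞)` is a cusp of `Γ₀(N)`, fixed by `η`), and
  `r ∈ [0, 1)` is determined by `e(r) = t^(2ℓ+1)`, the function `f|[ρ]` has an expansion
  `∑_{n ∈ ℤ, n + r > 0} c_n e((n + r) z)`. -/
structure IsCuspForm (l N : ℕ) (f : ℍ → ℂ) : Prop where
  holo : MDifferentiable 𝓘(ℂ) 𝓘(ℂ) f
  slash_eq : ∀ g : CongruenceSubgroup.Gamma0 4,
    (g : SL(2, ℤ)) ∈ CongruenceSubgroup.Gamma0 N → slash l (lift g) f = f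
  cusp : ∀ (ρ : Gt) (η : CongruenceSubgroup.Gamma0 4) (t : Circle) (r : ℝ),
    (η : SL(2, ℤ)) ∈ CongruenceSubgroup.Gamma0 N →
    ρ⁻¹ * lift η * ρ = translation t →
    0 ≤ r → r < 1 → Complex.exp (2 * Real.pi * Complex.I * r) = (t : ℂ) ^ (2 * l + 1) →
    ∃ c : ℤ → ℂ, (∀ n : ℤ, (n : ℝ) + r ≤ 0 → c n = 0) ∧
      ∀ z : ℍ, HasSum (fun n : ℤ => c n * Complex.exp (2 * Real.pi * Complex.I * (n + r) * z))
        (slash l ρ f z)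

section Hecke

variable (p : ℕ) [hp : Fact p.Prime]

/-- `α_b^⋆ = ((1 b; 0 p²), p^{1/2})`. -/
def alphaStar (b : ℕ) : Gt :=
  upper 1 b ((p : ℝ) ^ 2) ((√(p : ℝ) : ℝ) : ℂ) one_pos
    (by have := hp.out.pos; positivity)
    (by
      rw [Complex.norm_of_nonneg (Real.sqrt_nonneg _), Real.sq_sqrt (Nat.cast_nonneg _), one_mul,
        Real.sqrt_sq (Nat.cast_nonneg _), sq])

/-- `β_h^⋆ = ((p h; 0 p), ε_p⁻¹ (-h/p))`, for `1 ≤ h < p`. -/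
def betaStar (h : Finset.Ico 1 p) : Gt :=
  upper p (h : ℕ) p ((eps p)⁻¹ * (jacobiSym (-((h : ℕ) : ℤ)) p : ℂ))
    (by exact_mod_cast hp.out.pos) (by exact_mod_cast hp.out.pos)
    (by
      have hh := Finset.mem_Ico.mp h.2
      have h1 : jacobiSym (-((h : ℕ) : ℤ)) p ^ 2 = 1 := by
        apply jacobiSym.sq_one
        rw [Int.neg_gcd]
        exact (Nat.coprime_of_lt_prime (by omega) hh.2 hp.out).symm
      have h2 : ‖((jacobiSym (-((h : ℕ) : ℤ)) p : ℤ) : ℂ)‖ ^ 2 = 1 := by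
        rw [← norm_pow]
        have : ((jacobiSym (-((h : ℕ) : ℤ)) p : ℤ) : ℂ) ^ 2 = 1 := by exact_mod_cast h1
        rw [this, norm_one]
      rw [norm_mul, mul_pow, h2, norm_inv, norm_eps, Real.sqrt_mul_self (Nat.cast_nonneg _)]
      simp)

/-- `σ^⋆ = ((p² 0; 0 1), p^{-1/2})`. -/
def sigmaStar : Gt :=
  upper ((p : ℝ) ^ 2) 0 1 (((√(p : ℝ))⁻¹ : ℝ) : ℂ)
    (by have := hp.out.pos; positivity) one_pos
    (by
      have h0 : (0 : ℝ) < p := by exact_mod_cast hp.out.pos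
      rw [Complex.norm_of_nonneg (inv_nonneg.mpr (Real.sqrt_nonneg _)), inv_pow,
        Real.sq_sqrt h0.le, mul_one, Real.sqrt_sq h0.le, inv_mul_cancel₀ h0.ne'])

/-- The Hecke operator `T(p²)` in weight `ℓ + 1/2`, for a prime `p` not dividing the level. -/
def heckeT (l : ℕ) (f : ℍ → ℂ) : ℍ → ℂ := fun z =>
  (((p : ℝ) ^ ((l : ℝ) - 3 / 2) : ℝ) : ℂ) *
    (∑ b ∈ Finset.range (p ^ 2), slash l (alphaStar p b) f z
      + ∑ h : Finset.Ico 1 p, slash l (betaStar p h) f z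
      + slash l (sigmaStar p) f z)

/-- `f` is a (nonzero) cusp form of weight `ℓ + 1/2` for `Γ₀(N)` that is an eigenform of `T(p²)`
with eigenvalue `ω`. -/
def IsHeckeEigenform (l N : ℕ) (f : ℍ → ℂ) (ω : ℂ) : Prop :=
  IsCuspForm l N f ∧ f ≠ 0 ∧ ∀ z, heckeT p l f z = ω * f z

end Hecke

/-- `ρ_{-1/2} = ((1 0; -2 1), (-2z+1)^{1/2})`. -/
def rhoHalf : Gt where
  mat := glPos 1 0 (-2) 1 (by norm_num)
  phi := fun z => (-2 * (z : ℂ) + 1) ^ (1 / 2 : ℂ)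
  holo := by simpa using mdiff_sqrt_linear (-2) 1
  sq_eq := ⟨1, by simp, fun z => by rw [cpow_half_sq, glPos_det, glPos_denom]; simp⟩

/-- `ρ_0 = ((0 -1; 4 0), 2^{1/2} (-iz)^{1/2})`. -/
def rhoZero : Gt where
  mat := glPos 0 (-1) 4 0 (by norm_num)
  phi := fun z => ((√2 : ℝ) : ℂ) * (-Complex.I * (z : ℂ)) ^ (1 / 2 : ℂ)
  holo := by
    refine mdifferentiable_const.mul (mdiff_cpow_half ?_ fun z => ?_)
    · simpa using mdiff_linear (-Complex.I) 0
    · left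
      simpa using z.im_pos
  sq_eq := by
    refine ⟨-Complex.I, by simp, fun z => ?_⟩
    rw [mul_pow, cpow_half_sq, glPos_det, glPos_denom]
    have h4 : √((0 : ℝ) * 0 - -1 * 4) = 2 := by
      rw [show ((0 : ℝ) * 0 - -1 * 4) = 2 ^ 2 by norm_num]
      exact Real.sqrt_sq (by norm_num)
    have h2 : ((√2 : ℝ) : ℂ) ^ 2 = 2 := by
      exact_mod_cast Real.sq_sqrt (by norm_num : (0 : ℝ) ≤ 2)
    rw [h4, h2]
    push_cast
    ring

/-- `α = ((4 0; 0 1), 2^{-1/2})`. -/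
def alphaFour : Gt :=
  upper 4 0 1 (((√2)⁻¹ : ℝ) : ℂ) (by norm_num) one_pos (by
    rw [Complex.norm_of_nonneg (inv_nonneg.mpr (Real.sqrt_nonneg _)), inv_pow,
      Real.sq_sqrt (by norm_num), mul_one, show (4 : ℝ) = 2 ^ 2 by norm_num,
      Real.sqrt_sq (by norm_num)]
    norm_num)

/-- `𝔤 = (𝔣|[ρ_{-1/2}])|[α]`. -/
def gForm (l : ℕ) (f : ℍ → ℂ) : ℍ → ℂ := slash l alphaFour (slash l rhoHalf f)

/-- `𝔥 = 𝔣|[ρ_0]`. -/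
def hForm (l : ℕ) (f : ℍ → ℂ) : ℍ → ℂ := slash l rhoZero f

end

end HalfIntegral

/-! Up to a nonzero constant, `𝔤` is obtained from `𝔣` by three elementary operations: the Fricke
involution of level 4, the translation `z ↦ z + 1/2`, and the Fricke involution of level 16. The
underlying matrix identity holds up to the scalar `-4`, which acts trivially (`exists_gForm_eq`).
Since `𝔥` is the first of these operations applied to `𝔣`, it suffices that each operation preserves
eigenforms of `T(p²)` with their eigenvalue, at level 4 or 16.

For an operation `ρ` two facts are needed. It must normalise the lifted group, `ρ γ* = γ'* ρ`, which
gives invariance and transports the cusp condition (`IsCuspForm.slash_of_conj`). It must also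
permute the representatives of `T(p²)` modulo left multiplication by lifts, which `f` does not see
(`heckeT_slash`).

Each identity in `G̃` splits into a matrix identity and one value of the automorphy factor at `i`
(`Gt.ext_of_phi_I`). For Fricke (`fricke_mul_lift`) the branch of the square root at `i` produces
exactly the sign given by quadratic reciprocity (`extSym_fricke`). For the half translation
(`halfShift_mul_lift`) the key is the periodicity of the extended symbol (`extSym_congr_right`). -/

namespace HalfIntegral

noncomputable section

/-! ### Matrices, automorphy factors and the slash action -/

lemma coe_glPos_smul (a b c d : ℝ) (h : 0 < a * d - b * c) (z : ℍ) :
    ((glPos a b c d h • z : ℍ) : ℂ) = (a * z + b) / (c * z + d) := by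
  have h1 := coe_smul_of_det_pos (g := ((glPos a b c d h : GL(2, ℝ)⁺) : GL (Fin 2) ℝ))
    (glPos a b c d h).2 z
  rw [glPos_denom] at h1
  refine h1.trans ?_
  simp [num, glPos, Matrix.GeneralLinearGroup.mkOfDetNeZero]

lemma glPos_mul (a b c d a' b' c' d' : ℝ) (h : 0 < a * d - b * c) (h' : 0 < a' * d' - b' * c') :
    glPos a b c d h * glPos a' b' c' d' h' =
      glPos (a * a' + b * c') (a * b' + b * d') (c * a' + d * c') (c * b' + d * d')
        (by nlinarith [mul_pos h h']) := by
  ext i j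
  fin_cases i <;> fin_cases j <;>
    simp [glPos, Matrix.GeneralLinearGroup.mkOfDetNeZero, Matrix.mul_apply, Fin.sum_univ_two]

lemma glPos_congr {a b c d a' b' c' d' : ℝ} {h : 0 < a * d - b * c} {h' : 0 < a' * d' - b' * c'}
    (ha : a = a') (hb : b = b') (hc : c = c') (hd : d = d') :
    glPos a b c d h = glPos a' b' c' d' h' := by
  subst ha hb hc hd
  rfl

namespace Gt

lemma continuous_phi (x : Gt) : Continuous x.phi := x.holo.continuous

/-- The automorphy factors of two elements of `G̃` with the same matrix are proportional. -/
lemma exists_phi_eq (x y : Gt) (h : x.mat = y.mat) :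
    ∃ k : ℂ, k ≠ 0 ∧ ∀ z, x.phi z = k * y.phi z := by
  obtain ⟨s, hs, hx⟩ := x.sq_eq
  obtain ⟨t, ht, hy⟩ := y.sq_eq
  have hs0 : s ≠ 0 := by rintro rfl; simp at hs
  have ht0 : t ≠ 0 := by rintro rfl; simp at ht
  set k : ℂ := (s / t) ^ (1 / 2 : ℂ) with hk
  have hk2 : k ^ 2 = s / t := cpow_half_sq _
  have hk0 : k ≠ 0 := by
    intro h0
    rw [h0] at hk2
    exact div_ne_zero hs0 ht0 (by rw [← hk2]; norm_num)
  -- The two factors have proportional squares, and on the connected set `ℍ` a continuous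
  -- nonvanishing square root is unique up to one global sign.
  have hsq : Set.EqOn (x.phi ^ 2) ((fun z => k * y.phi z) ^ 2) Set.univ := by
    intro z _
    simp only [Pi.pow_apply]
    rw [mul_pow, hx, hy, hk2, h]
    field_simp
  rcases isPreconnected_univ.eq_or_eq_neg_of_sq_eq x.continuous_phi.continuousOn
    (continuous_const.mul y.continuous_phi).continuousOn hsq
    (fun _ => mul_ne_zero hk0 (y.phi_ne_zero _)) with h1 | h1
  · exact ⟨k, hk0, fun z => h1 (Set.mem_univ z)⟩
  · refine ⟨-k, neg_ne_zero.mpr hk0, fun z => ?_⟩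
    have h2 := h1 (Set.mem_univ z)
    rw [neg_mul]
    exact h2

/-- An element of `G̃` is determined by its matrix and one value of its automorphy factor. -/
lemma ext_of_phi_I {x y : Gt} (h : x.mat = y.mat) (hI : x.phi I = y.phi I) : x = y := by
  obtain ⟨k, -, hk⟩ := exists_phi_eq x y h
  have h1 : k = 1 := by
    have := hk I
    rw [hI] at this
    exact (mul_right_cancel₀ (y.phi_ne_zero I) (by rw [← this, one_mul]))
  ext1
  · exact h
  · funext z
    rw [hk, h1, one_mul]

end Gt

lemma slash_mul (l : ℕ) (x y : Gt) (f : ℍ → ℂ) :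
    slash l (x * y) f = slash l y (slash l x f) := by
  funext z
  simp only [slash, Gt.mul_phi, Gt.mul_mat, mul_smul, mul_zpow]
  ring

lemma slash_one (l : ℕ) (f : ℍ → ℂ) : slash l 1 f = f := by
  funext z
  simp [slash]

lemma slash_inv_slash (l : ℕ) (x : Gt) (f : ℍ → ℂ) : slash l x⁻¹ (slash l x f) = f := by
  rw [← slash_mul, mul_inv_cancel, slash_one]

lemma slash_zero (l : ℕ) (x : Gt) : slash l x 0 = 0 := by
  funext z
  simp [slash]

lemma slash_ne_zero (l : ℕ) (x : Gt) {f : ℍ → ℂ} (hf : f ≠ 0) : slash l x f ≠ 0 := by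
  intro h
  apply hf
  rw [← slash_inv_slash l x f, h, slash_zero]

lemma slash_const_mul (l : ℕ) (x : Gt) (k : ℂ) (f : ℍ → ℂ) :
    slash l x (fun z => k * f z) = fun z => k * slash l x f z := by
  funext z
  simp only [slash]
  ring

lemma slash_mdifferentiable (l : ℕ) (x : Gt) {f : ℍ → ℂ} (hf : MDifferentiable 𝓘(ℂ) 𝓘(ℂ) f) :
    MDifferentiable 𝓘(ℂ) 𝓘(ℂ) (slash l x f) := by
  have h1 := hf.comp (mdifferentiable_smul (g := (x.mat : GL (Fin 2) ℝ)) x.mat.2)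
  have h2 := x.holo
  have h3 : MDifferentiable 𝓘(ℂ) 𝓘(ℂ) (fun z => x.phi z ^ (-(2 * (l : ℤ) + 1))) := by
    rw [mdifferentiable_iff] at h2 ⊢
    exact h2.zpow (Or.inl fun z hz => x.phi_ne_zero _)
  exact h3.mul h1

lemma IsCuspForm.const_mul {l N : ℕ} {f : ℍ → ℂ} (hf : IsCuspForm l N f) (k : ℂ) :
    IsCuspForm l N (fun z => k * f z) where
  holo := mdifferentiable_const.mul hf.holo
  slash_eq g hg := by rw [slash_const_mul, hf.slash_eq g hg]
  cusp ρ η t r hη h h0 h1 hr := by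
    obtain ⟨c, hc, hs⟩ := hf.cusp ρ η t r hη h h0 h1 hr
    refine ⟨fun n => k * c n, fun n hn => by simp only [hc n hn, mul_zero], fun z => ?_⟩
    rw [slash_const_mul]
    simpa only [mul_assoc] using (hs z).mul_left k

lemma IsCuspForm.mono {l N N' : ℕ} {f : ℍ → ℂ} (hf : IsCuspForm l N f) (h : N ∣ N') :
    IsCuspForm l N' f := by
  have key : ∀ g : SL(2, ℤ), g ∈ CongruenceSubgroup.Gamma0 N' →
      g ∈ CongruenceSubgroup.Gamma0 N := by
    intro g hg
    rw [CongruenceSubgroup.Gamma0_mem, ZMod.intCast_zmod_eq_zero_iff_dvd] at hg ⊢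
    exact (Int.natCast_dvd_natCast.mpr h).trans hg
  exact ⟨hf.holo, fun g hg => hf.slash_eq g (key _ hg),
    fun ρ η t r hη => hf.cusp ρ η t r (key _ hη)⟩

/-- If `ρ` conjugates the lift of `Γ₀(N')` into the lift of `Γ₀(N)`, then `f ↦ f|[ρ]` maps cusp
forms for `Γ₀(N)` to cusp forms for `Γ₀(N')`. -/
lemma IsCuspForm.slash_of_conj {l N N' : ℕ} {f : ℍ → ℂ} (hf : IsCuspForm l N f) (ρ : Gt)
    (h : ∀ g : CongruenceSubgroup.Gamma0 4, (g : SL(2, ℤ)) ∈ CongruenceSubgroup.Gamma0 N' →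
      ∃ g' : CongruenceSubgroup.Gamma0 4, (g' : SL(2, ℤ)) ∈ CongruenceSubgroup.Gamma0 N ∧
        ρ * lift g = lift g' * ρ) :
    IsCuspForm l N' (slash l ρ f) where
  holo := slash_mdifferentiable l ρ hf.holo
  slash_eq g hg := by
    obtain ⟨g', hg', hc⟩ := h g hg
    rw [← slash_mul, hc, slash_mul, hf.slash_eq g' hg']
  -- The expansion of `f|[ρ]` at `ρ'` is that of `f` at `ρρ'`; conjugation leaves `t`, hence `r`,
  -- unchanged.
  cusp ρ' η t r hη ht h0 h1 hr := by
    obtain ⟨η', hη', hc⟩ := h η hη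
    have hc' : lift η = ρ⁻¹ * lift η' * ρ := by rw [mul_assoc, ← hc, inv_mul_cancel_left]
    rw [← slash_mul]
    refine hf.cusp (ρ * ρ') η' t r hη' ?_ h0 h1 hr
    rw [← ht, hc']
    group

/-! ### Coordinates on `Γ₀(4)` -/

/-- The element of `Γ₀(4)` with the given entries. -/
def gamma0Mk (a b c d : ℤ) (h : a * d - b * c = 1) (hc : 4 ∣ c) : CongruenceSubgroup.Gamma0 4 :=
  ⟨⟨!![a, b; c, d], by rw [Matrix.det_fin_two_of, h]⟩, by
    refine CongruenceSubgroup.Gamma0_mem.mpr ?_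
    exact (ZMod.intCast_zmod_eq_zero_iff_dvd c 4).mpr hc⟩

lemma gamma0Mk_mem {a b c d : ℤ} {h : a * d - b * c = 1} {hc : 4 ∣ c} {N : ℕ} (hN : (N : ℤ) ∣ c) :
    (gamma0Mk a b c d h hc : SL(2, ℤ)) ∈ CongruenceSubgroup.Gamma0 N := by
  rw [CongruenceSubgroup.Gamma0_mem]
  exact (ZMod.intCast_zmod_eq_zero_iff_dvd c N).mpr hN

lemma det_pos_of_int {a b c d : ℤ} (h : a * d - b * c = 1) :
    (0 : ℝ) < (a : ℝ) * (d : ℝ) - (b : ℝ) * (c : ℝ) := by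
  have : (0 : ℤ) < a * d - b * c := by omega
  exact_mod_cast this

lemma lift_gamma0Mk_mat (a b c d : ℤ) (h : a * d - b * c = 1) (hc : 4 ∣ c) :
    (lift (gamma0Mk a b c d h hc)).mat = glPos a b c d (det_pos_of_int h) := rfl

lemma lift_gamma0Mk_phi (a b c d : ℤ) (h : a * d - b * c = 1) (hc : 4 ∣ c) (z : ℍ) :
    (lift (gamma0Mk a b c d h hc)).phi z =
      (eps d)⁻¹ * (extSym c d : ℂ) * ((c : ℂ) * (z : ℂ) + (d : ℂ)) ^ (1 / 2 : ℂ) := rfl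

lemma exists_eq_gamma0Mk {N : ℕ} (g : CongruenceSubgroup.Gamma0 4)
    (hg : (g : SL(2, ℤ)) ∈ CongruenceSubgroup.Gamma0 N) :
    ∃ (a b c d : ℤ) (h : a * d - b * c = 1) (hc : 4 ∣ c), (N : ℤ) ∣ c ∧
      g = gamma0Mk a b c d h hc := by
  have hd := (g : SL(2, ℤ)).det_coe
  rw [Matrix.det_fin_two] at hd
  have h4 := g.2
  rw [CongruenceSubgroup.Gamma0_mem, ZMod.intCast_zmod_eq_zero_iff_dvd] at h4 hg
  refine ⟨_, _, _, _, hd, by exact_mod_cast h4, hg, ?_⟩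
  ext i j
  fin_cases i <;> fin_cases j <;> rfl

/-! ### Branches of the principal square root -/

lemma sqrt_mul_of_arg_add_mem {x y : ℂ} (hx : x ≠ 0) (hy : y ≠ 0)
    (h : x.arg + y.arg ∈ Set.Ioc (-Real.pi) Real.pi) :
    (x * y) ^ (1 / 2 : ℂ) = x ^ (1 / 2 : ℂ) * y ^ (1 / 2 : ℂ) := by
  rw [Complex.cpow_def_of_ne_zero (mul_ne_zero hx hy), Complex.cpow_def_of_ne_zero hx,
    Complex.cpow_def_of_ne_zero hy, Complex.log_mul hx hy h, ← Complex.exp_add]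
  ring_nf

lemma sqrt_mul_of_re_pos {x y : ℂ} (hx : 0 < x.re) (hy : 0 < y.re) :
    (x * y) ^ (1 / 2 : ℂ) = x ^ (1 / 2 : ℂ) * y ^ (1 / 2 : ℂ) := by
  have hx' := abs_lt.mp (Complex.abs_arg_lt_pi_div_two_iff.mpr (Or.inl hx))
  have hy' := abs_lt.mp (Complex.abs_arg_lt_pi_div_two_iff.mpr (Or.inl hy))
  refine sqrt_mul_of_arg_add_mem ?_ ?_ ⟨by linarith, by linarith⟩
  · rintro rfl
    simp at hx
  · rintro rfl
    simp at hy

lemma sqrt_neg_one : (-1 : ℂ) ^ (1 / 2 : ℂ) = Complex.I := by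
  rw [Complex.cpow_def_of_ne_zero (by norm_num), Complex.log_neg_one,
    show (Real.pi : ℂ) * Complex.I * (1 / 2) = Real.pi / 2 * Complex.I by ring,
    Complex.exp_pi_div_two_mul_I]

/-- Here `arg (-x) ≤ 0`, so adding `arg (-1) = π` stays within the principal range. The condition on
the negative real axis reflects that the cut belongs to the upper side. -/
lemma sqrt_neg_of_im_nonneg {x : ℂ} (h : 0 < x.im ∨ x.im = 0 ∧ x.re < 0) :
    x ^ (1 / 2 : ℂ) = Complex.I * (-x) ^ (1 / 2 : ℂ) := by
  have hx : -x ≠ 0 := by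
    rw [neg_ne_zero]
    rintro rfl
    simp at h
  have h1 : (-x).arg ≤ 0 := by
    rcases h with h | ⟨h, h'⟩
    · exact (Complex.arg_neg_iff.mpr (by simpa using h)).le
    · exact (Complex.arg_eq_zero_iff.mpr ⟨by simpa using h'.le, by simpa using h⟩).le
  have h2 := Complex.neg_pi_lt_arg (-x)
  rw [← sqrt_neg_one, ← sqrt_mul_of_arg_add_mem (by norm_num) hx]
  · simp
  · rw [Complex.arg_neg_one]
    exact ⟨by linarith [Real.pi_pos], by linarith⟩

lemma sqrt_neg_of_im_neg {x : ℂ} (h : x.im < 0) :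
    x ^ (1 / 2 : ℂ) = -Complex.I * (-x) ^ (1 / 2 : ℂ) := by
  have h1 := sqrt_neg_of_im_nonneg (x := -x) (Or.inl (by simpa using h))
  rw [h1, neg_neg, ← mul_assoc]
  simp

/-- The sign by which the principal square root of `x y` differs from the product of the square
roots, when `x` lies in the right half plane. -/
lemma sqrt_mul_of_re_neg {x y : ℂ} (hx : 0 < x.re) (hy : y.re < 0)
    (h0 : (x * y).im = 0 → (x * y).re < 0) :
    x ^ (1 / 2 : ℂ) * y ^ (1 / 2 : ℂ) =
      (if (0 ≤ y.im ↔ 0 ≤ (x * y).im) then 1 else -1) * (x * y) ^ (1 / 2 : ℂ) := by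
  have h1 : (-(x * y)) ^ (1 / 2 : ℂ) = x ^ (1 / 2 : ℂ) * (-y) ^ (1 / 2 : ℂ) := by
    rw [← mul_neg]
    exact sqrt_mul_of_re_pos hx (by simpa using hy)
  have key : ∀ w : ℂ, (w.im = 0 → w.re < 0) →
      w ^ (1 / 2 : ℂ) = (if 0 ≤ w.im then 1 else -1) * Complex.I * (-w) ^ (1 / 2 : ℂ) := by
    intro w hw
    split_ifs with h
    · rw [one_mul]
      apply sqrt_neg_of_im_nonneg
      rcases h.lt_or_eq with h | h
      · exact Or.inl h
      · exact Or.inr ⟨h.symm, hw h.symm⟩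
    · rw [neg_one_mul]
      exact sqrt_neg_of_im_neg (not_le.mp h)
  rw [key y (fun _ => hy), key (x * y) h0, h1]
  generalize (x * y).im = s
  generalize y.im = t
  split_ifs <;> first | (exfalso; tauto) | ring

lemma sqrt_ofReal {x : ℝ} (hx : 0 ≤ x) : (x : ℂ) ^ (1 / 2 : ℂ) = (√x : ℝ) := by
  rw [Real.sqrt_eq_rpow, Complex.ofReal_cpow hx]
  norm_num

lemma sqrt_ofReal_mul {x : ℝ} (hx : 0 < x) (w : ℂ) :
    ((x : ℂ) * w) ^ (1 / 2 : ℂ) = (√x : ℝ) * w ^ (1 / 2 : ℂ) := by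
  by_cases hw : w = 0
  · subst hw
    simp
  · rw [sqrt_mul_of_arg_add_mem (by exact_mod_cast hx.ne') hw, sqrt_ofReal hx.le]
    rw [Complex.arg_ofReal_of_nonneg hx.le, zero_add]
    exact Complex.arg_mem_Ioc w

/-! ### Jacobi symbols and reciprocity -/

lemma gcd_natAbs_right (x a : ℤ) : Int.gcd x (a.natAbs : ℤ) = Int.gcd x a := by
  rw [Int.gcd_eq_natAbs_gcd_natAbs, Int.natAbs_natCast, ← Int.gcd_eq_natAbs_gcd_natAbs]

lemma jacobiSym_eq_one_of_one_mod (b : ℤ) (n m : ℕ) (hn : n = 4 * b.natAbs * m + 1) :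
    jacobiSym b n = 1 := by
  rcases Nat.eq_zero_or_pos b.natAbs with h | h
  · rw [hn, h]
    simp
  · have hodd : Odd n := by
      rw [hn]
      exact ⟨2 * b.natAbs * m, by ring⟩
    rw [jacobiSym.mod_right b hodd, hn, Nat.mul_add_mod, Nat.mod_eq_of_lt (by omega),
      jacobiSym.one_right]

/-- Since 4 is a square, `(x/n) = (m/n)` and `(x/m) = (n/m)`. As `n + m ≡ 0 (mod 4)`, one of the two
is `1` mod 4, so reciprocity carries no sign. -/
lemma jacobiSym_natCast_eq_of_add_eq_four_mul {x n m : ℕ} (hn : Odd n) (h : n + m = 4 * x) :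
    jacobiSym x n = jacobiSym x m := by
  rw [Nat.odd_iff] at hn
  have hm : m % 2 = 1 := by omega
  have key : ∀ u v : ℕ, Odd u → u + v = 4 * x → jacobiSym x u = jacobiSym v u := by
    intro u v hu huv
    rw [← one_mul (jacobiSym x u), ← jacobiSym.at_four hu, ← jacobiSym.mul_left]
    apply jacobiSym.mod_left'
    have : (4 * x : ℤ) = v + u := by exact_mod_cast (by omega : 4 * x = v + u)
    rw [this, Int.add_emod_right]
  rw [key n m (Nat.odd_iff.mpr hn) h, key m n (Nat.odd_iff.mpr hm) (by omega)]
  rcases (by omega : n % 4 = 1 ∨ m % 4 = 1) with h4 | h4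
  · exact jacobiSym.quadratic_reciprocity_one_mod_four' (Nat.odd_iff.mpr hm) h4
  · exact jacobiSym.quadratic_reciprocity_one_mod_four h4 (Nat.odd_iff.mpr hn)

/-- For `x > 0` the Jacobi symbol `(x/n)` is an even function of `n` modulo `4x`. -/
lemma jacobiSym_natCast_eq_of_dvd_add {x n m : ℕ} (hx : 0 < x) (hn : Odd n)
    (h : 4 * x ∣ n + m) : jacobiSym x n = jacobiSym x m := by
  have hm : Odd m := by
    have h2 : 2 ∣ n + m := (Dvd.intro (2 * x) (by ring)).trans h
    rw [Nat.odd_iff] at hn ⊢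
    omega
  rw [jacobiSym.mod_right' x hn, jacobiSym.mod_right' x hm]
  have hmod : ∀ u : ℕ, Odd u → Odd (u % (4 * x)) := by
    intro u hu
    rw [Nat.odd_iff] at hu ⊢
    rw [Nat.mod_mod_of_dvd _ (Dvd.intro (2 * x) (by ring)), hu]
  apply jacobiSym_natCast_eq_of_add_eq_four_mul (hmod n hn)
  have h1 : 4 * x ∣ n % (4 * x) + m % (4 * x) := by
    rw [Nat.dvd_iff_mod_eq_zero, ← Nat.add_mod]
    exact Nat.mod_eq_zero_of_dvd h
  have h2 := Nat.mod_lt n (show 0 < 4 * x by omega)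
  have h3 := Nat.mod_lt m (show 0 < 4 * x by omega)
  have h4 := (hmod n hn).pos
  obtain ⟨t, ht⟩ := h1
  -- The two residues have a sum strictly between `0` and `8x`, so the only possible multiple of
  -- `4x` is `4x` itself.
  have ht1 : t = 1 := by
    have : 0 < t := by
      rcases Nat.eq_zero_or_pos t with h0 | h0
      · subst h0
        omega
      · exact h0
    have : t < 2 := by
      by_contra h5
      have : 4 * x * 2 ≤ 4 * x * t := Nat.mul_le_mul_left _ (by omega)
      omega
    omega
  rw [ht, ht1, mul_one]

/-- The extended symbol `(x/d)` is periodic in `d` modulo `4x`. -/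
lemma extSym_congr_right {x d d' : ℤ} (hd : Odd d) (h : 4 * x ∣ d - d') :
    extSym x d = extSym x d' := by
  have hd' : Odd d' := by
    have h2 : 2 ∣ d - d' := (Dvd.intro (2 * x) (by ring)).trans h
    rw [Int.odd_iff] at hd ⊢
    omega
  have hdn : Odd d.natAbs := Int.natAbs_odd.mpr hd
  have hdn' : Odd d'.natAbs := Int.natAbs_odd.mpr hd'
  have same : (d < 0 ↔ d' < 0) → jacobiSym x d.natAbs = jacobiSym x d'.natAbs := by
    intro hs
    rw [jacobiSym.mod_right x hdn, jacobiSym.mod_right x hdn']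
    congr 1
    have h1 : ((4 * x.natAbs : ℕ) : ℤ) ∣ d.natAbs - d'.natAbs := by
      push_cast
      rw [← Int.natAbs_dvd, Int.natAbs_mul, Int.natAbs_abs, ← Int.natAbs_mul, Int.natAbs_dvd]
      rcases lt_or_ge d 0 with h0 | h0
      · rw [abs_of_neg h0, abs_of_neg (hs.mp h0)]
        have := h.neg_right
        rwa [neg_sub'] at this
      · rw [abs_of_nonneg h0, abs_of_nonneg (by omega)]
        exact h
    exact ((Nat.modEq_iff_dvd.mpr h1).symm)
  -- For opposite signs `|d| + |d'| = |d - d'|`, so evenness applies to `(|x|/·)`. When `x < 0`, the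
  -- change of sign of `χ₄` is undone by the sign convention in `extSym`.
  have opp : (d < 0 ↔ 0 ≤ d') → x ≠ 0 →
      jacobiSym x.natAbs d.natAbs = jacobiSym x.natAbs d'.natAbs ∧
        ZMod.χ₄ d.natAbs = -ZMod.χ₄ d'.natAbs := by
    intro hs hx
    have h1 : 4 * x.natAbs ∣ d.natAbs + d'.natAbs := by
      have h2 : d.natAbs + d'.natAbs = (d - d').natAbs := by omega
      rw [h2, show 4 * x.natAbs = (4 * x).natAbs by rw [Int.natAbs_mul]; rfl]
      exact Int.natAbs_dvd_natAbs.mpr h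
    refine ⟨jacobiSym_natCast_eq_of_dvd_add (by omega) hdn h1, ?_⟩
    have h3 : 4 ∣ d.natAbs + d'.natAbs := (Dvd.intro _ rfl).trans h1
    rw [Nat.odd_iff] at hdn hdn'
    rcases (by omega : d.natAbs % 4 = 1 ∧ d'.natAbs % 4 = 3 ∨ d.natAbs % 4 = 3 ∧ d'.natAbs % 4 = 1)
      with ⟨h4, h5⟩ | ⟨h4, h5⟩
    · rw [ZMod.χ₄_nat_one_mod_four h4, ZMod.χ₄_nat_three_mod_four h5, neg_neg]
    · rw [ZMod.χ₄_nat_one_mod_four h5, ZMod.χ₄_nat_three_mod_four h4]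
  unfold extSym
  by_cases hs : d < 0 ↔ d' < 0
  · rw [same hs]
    simp only [hs]
  · rcases lt_trichotomy x 0 with hx | rfl | hx
    · obtain ⟨h1, h2⟩ := opp (by omega) hx.ne
      have hx' : x = -(x.natAbs : ℤ) := by omega
      have h3 : ∀ n : ℕ, Odd n → jacobiSym x n = ZMod.χ₄ n * jacobiSym x.natAbs n := by
        intro n hn
        conv_lhs => rw [hx']
        exact jacobiSym.neg _ hn
      rw [h3 _ hdn, h3 _ hdn', h1, h2]
      split_ifs <;> first | (exfalso; omega) | ring
    · exact absurd h (by rw [mul_zero, zero_dvd_iff]; omega)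
    · obtain ⟨h1, -⟩ := opp (by omega) hx.ne'
      rw [Int.natAbs_of_nonneg hx.le] at h1
      rw [h1, if_neg (by omega), if_neg (by omega)]

/-- Evenness modulo `4|b|` compares `n` with `1`, so `(|b|/n) = 1`. As `n ≡ 3 (mod 4)`, the factor
`(-1/n)` is `-1`. -/
lemma jacobiSym_neg_of_neg_one_mod (b : ℤ) (n m : ℕ) (hb : b ≠ 0)
    (hn : n + 1 = 4 * b.natAbs * m) : jacobiSym (-b) n = if 0 < b then -1 else 1 := by
  have h1 : jacobiSym b.natAbs n = 1 := by
    rw [jacobiSym_natCast_eq_of_dvd_add (m := 1) (by omega) _ ⟨m, hn⟩, jacobiSym.one_right]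
    have : 4 * b.natAbs * m = 2 * (2 * b.natAbs * m) := by ring
    exact Nat.odd_iff.mpr (by omega)
  have hm : n % 4 = 3 := by
    have : 4 * b.natAbs * m = 4 * (b.natAbs * m) := by ring
    omega
  split_ifs with h
  · rw [Int.natAbs_of_nonneg h.le] at h1
    rw [jacobiSym.neg _ (Nat.odd_iff.mpr (by omega)), h1, ZMod.χ₄_nat_three_mod_four hm]
    norm_num
  · rwa [Int.ofNat_natAbs_of_nonpos (not_lt.mp h)] at h1

/-- Reciprocity for the symbols attached to a matrix of `Γ₀(4)`. -/
lemma jacobiSym_gamma0 {a b c d : ℤ} (h : a * d - b * c = 1) (hc : 4 ∣ c) :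
    jacobiSym c d.natAbs =
      jacobiSym (-b) a.natAbs * (if 0 < b ∧ a * d < 0 then -1 else 1) := by
  obtain ⟨e, rfl⟩ := hc
  have had : a * d = 4 * (b * e) + 1 := by linarith
  have had0 : a * d ≠ 0 := by omega
  have ha : a.natAbs ≠ 0 := by
    rw [Int.natAbs_ne_zero]
    exact left_ne_zero_of_mul had0
  have hd : d.natAbs ≠ 0 := by
    rw [Int.natAbs_ne_zero]
    exact right_ne_zero_of_mul had0
  -- The determinant condition gives `-bc ≡ 1 (mod d)`.
  have h1 : jacobiSym (-b) d.natAbs * jacobiSym (4 * e) d.natAbs = 1 := by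
    rw [← jacobiSym.mul_left, ← jacobiSym.one_left d.natAbs]
    apply jacobiSym.mod_left'
    rw [Int.emod_eq_emod_iff_emod_sub_eq_zero]
    apply Int.emod_eq_zero_of_dvd
    rw [Int.natAbs_dvd]
    exact ⟨-a, by linarith⟩
  -- Because `ad = 1 + 4be`, the modulus `|ad|` is `±1` mod `4|b|` with the sign of `ad`.
  have h2 : jacobiSym (-b) a.natAbs * jacobiSym (-b) d.natAbs =
      if 0 < b ∧ a * d < 0 then -1 else 1 := by
    rw [← jacobiSym.mul_right' _ ha hd, ← Int.natAbs_mul]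
    rcases lt_or_gt_of_ne had0 with hneg | hpos
    · have hb : b ≠ 0 := by
        rintro rfl
        simp at had
        omega
      rw [jacobiSym_neg_of_neg_one_mod b _ e.natAbs hb]
      · simp only [hneg, and_true]
      · rw [mul_assoc, ← Int.natAbs_mul]
        omega
    · rw [if_neg (by omega)]
      apply jacobiSym_eq_one_of_one_mod (-b) _ e.natAbs
      rw [Int.natAbs_neg, mul_assoc, ← Int.natAbs_mul]
      omega
  have h3 : jacobiSym (-b) d.natAbs = jacobiSym (4 * e) d.natAbs := Int.eq_of_mul_eq_one h1
  have h4 : jacobiSym (-b) a.natAbs ^ 2 = 1 := by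
    apply jacobiSym.sq_one
    rw [gcd_natAbs_right, ← Int.isCoprime_iff_gcd_eq_one]
    exact ⟨4 * e, d, by linarith⟩
  rw [← h2, ← mul_assoc, ← sq, h4, one_mul, h3]

lemma jacobiSym_sq_mul (k x : ℤ) (n : ℕ) (h : IsCoprime k n) :
    jacobiSym (k ^ 2 * x) n = jacobiSym x n := by
  rw [jacobiSym.mul_left, jacobiSym.sq_one', one_mul]
  rwa [Int.isCoprime_iff_gcd_eq_one] at h

lemma eps_congr {a d : ℤ} (h : a % 4 = d % 4) : eps a = eps d := by
  rw [eps, eps, h]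

lemma eps_eq_of_mul_eq {q D x : ℤ} (h : q * D = 4 * x + 1) : eps q = eps D := by
  apply eps_congr
  have h2 : (q * D) % 4 = 1 := by omega
  rw [Int.mul_emod] at h2
  have ha := Int.emod_nonneg q (show (4 : ℤ) ≠ 0 by norm_num)
  have ha' := Int.emod_lt_of_pos q (show (0 : ℤ) < 4 by norm_num)
  have hd := Int.emod_nonneg D (show (4 : ℤ) ≠ 0 by norm_num)
  have hd' := Int.emod_lt_of_pos D (show (0 : ℤ) < 4 by norm_num)
  interval_cases q % 4 <;> interval_cases D % 4 <;> omega

/-- The comparison of the extended symbols of `(a b; c d)` and of its conjugate by the Fricke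
involution of level `k²`. -/
lemma extSym_fricke {a b c d : ℤ} (k : ℕ) (hk : 0 < k) (h : a * d - b * c = 1) (hc : 4 ∣ c)
    (hkc : (k : ℤ) ∣ c) :
    extSym c d = extSym (-((k : ℤ) ^ 2 * b)) a *
      if d < 0 then (if (0 ≤ c ↔ b ≤ 0) then 1 else -1) else 1 := by
  have hcop : IsCoprime (k : ℤ) a.natAbs := by
    rw [Int.isCoprime_iff_gcd_eq_one, gcd_natAbs_right, ← Int.isCoprime_iff_gcd_eq_one]
    obtain ⟨e, rfl⟩ := hkc
    exact ⟨-(b * e), d, by linarith⟩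
  have hkb : -((k : ℤ) ^ 2 * b) < 0 ↔ 0 < b := by
    rw [neg_lt_zero]
    exact mul_pos_iff_of_pos_left (by positivity)
  have hj : jacobiSym (-((k : ℤ) ^ 2 * b)) a.natAbs = jacobiSym (-b) a.natAbs := by
    rw [← mul_neg, jacobiSym_sq_mul _ _ _ hcop]
  have hbc : b * c + 1 = a * d := by linarith
  have had0 : a * d ≠ 0 := by
    obtain ⟨e, rfl⟩ := hc
    have : b * (4 * e) = 4 * (b * e) := by ring
    omega
  have ha := left_ne_zero_of_mul had0
  have hd := right_ne_zero_of_mul had0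
  -- From `bc = ad - 1`, the sign of `ad` restricts the signs of `b` and `c`; what remains is a
  -- finite case check.
  have hsign : (a * d < 0 ↔ (a < 0 ↔ 0 < d)) ∧
      (a * d < 0 → b < 0 ∧ 0 < c ∨ 0 < b ∧ c < 0) ∧
      (0 < a * d → 0 ≤ b ∧ 0 ≤ c ∨ b ≤ 0 ∧ c ≤ 0) := by
    refine ⟨?_, fun h0 => ?_, fun h0 => ?_⟩
    · rw [mul_neg_iff]
      omega
    · have : b * c < 0 := by omega
      rw [mul_neg_iff] at this
      omega
    · exact mul_nonneg_iff.mp (by omega)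
  simp only [extSym, hkb, hj, jacobiSym_gamma0 h hc]
  generalize jacobiSym (-b) a.natAbs = J
  generalize a * d = s at *
  split_ifs <;> first | (exfalso; omega) | ring

/-! ### The Fricke involution normalises the lifted group -/

/-- The Fricke involution `((0 -1; k² 0), k^{1/2} (-iz)^{1/2})` of level `k²`. -/
def fricke (k : ℕ) (hk : 0 < k) : Gt where
  mat := glPos 0 (-1) ((k : ℝ) ^ 2) 0 (by
    have : (0 : ℝ) < k := by exact_mod_cast hk
    rw [zero_mul, zero_sub, neg_one_mul, neg_neg]
    positivity)
  phi := fun z => ((√(k : ℝ) : ℝ) : ℂ) * (-Complex.I * (z : ℂ)) ^ (1 / 2 : ℂ)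
  holo := by
    refine mdifferentiable_const.mul (mdiff_cpow_half ?_ fun z => ?_)
    · simpa using mdiff_linear (-Complex.I) 0
    · left
      simpa using z.im_pos
  sq_eq := by
    refine ⟨-Complex.I, by simp, fun z => ?_⟩
    have hk0 : (k : ℂ) ≠ 0 := by exact_mod_cast hk.ne'
    rw [mul_pow, cpow_half_sq, glPos_det, glPos_denom]
    have h4 : √((0 : ℝ) * 0 - -1 * (k : ℝ) ^ 2) = k := by
      rw [zero_mul, zero_sub, neg_one_mul, neg_neg, Real.sqrt_sq (Nat.cast_nonneg _)]
    have h2 : ((√(k : ℝ) : ℝ) : ℂ) ^ 2 = k := by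
      exact_mod_cast Real.sq_sqrt (Nat.cast_nonneg k)
    rw [h4, h2]
    push_cast
    field_simp
    ring

lemma fricke_phi (k : ℕ) (hk : 0 < k) (z : ℍ) :
    (fricke k hk).phi z = ((√(k : ℝ) : ℝ) : ℂ) * (-Complex.I * (z : ℂ)) ^ (1 / 2 : ℂ) := rfl

lemma fricke_phi_I (k : ℕ) (hk : 0 < k) : (fricke k hk).phi I = ((√(k : ℝ) : ℝ) : ℂ) := by
  rw [fricke_phi, coe_I, neg_mul, Complex.I_mul_I]
  simp

lemma coe_fricke_smul_I (k : ℕ) (hk : 0 < k) :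
    (((fricke k hk).mat • I : ℍ) : ℂ) = Complex.I / (k : ℂ) ^ 2 := by
  have hk0 : (k : ℂ) ≠ 0 := by exact_mod_cast hk.ne'
  rw [fricke, coe_glPos_smul]
  simp only [coe_I]
  push_cast
  rw [div_eq_div_iff (by simpa using hk0) (pow_ne_zero 2 hk0)]
  linear_combination -(k : ℂ) ^ 2 * Complex.I_sq

/-- The level being a perfect square, no quadratic character appears. At `i`, the branch sign of the
square root and the sign in `extSym_fricke` coincide, so they cancel. -/
lemma fricke_mul_lift (k : ℕ) (hk : 0 < k) {a b c d e : ℤ} (h : a * d - b * c = 1) (hc : 4 ∣ c)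
    (he : c = (k : ℤ) ^ 2 * e) (hk4 : 4 ∣ (k : ℤ) ^ 2)
    (h' : d * a - (-e) * (-((k : ℤ) ^ 2 * b)) = 1) :
    fricke k hk * lift (gamma0Mk a b c d h hc) =
      lift (gamma0Mk d (-e) (-((k : ℤ) ^ 2 * b)) a h' ((hk4.mul_right b).neg_right)) *
        fricke k hk := by
  have hk0 : (k : ℂ) ≠ 0 := by exact_mod_cast hk.ne'
  have hcd : (c : ℂ) * Complex.I + d ≠ 0 := by
    intro h0
    have h1 := congrArg Complex.re h0
    have h2 := congrArg Complex.im h0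
    simp at h1 h2
    norm_cast at h1 h2
    simp [h1, h2] at h
  apply Gt.ext_of_phi_I
  · rw [Gt.mul_mat, Gt.mul_mat, lift_gamma0Mk_mat, lift_gamma0Mk_mat, fricke, glPos_mul, glPos_mul]
    apply glPos_congr <;> push_cast [he] <;> ring
  · rw [Gt.mul_phi, Gt.mul_phi, fricke_phi_I, fricke_phi, lift_gamma0Mk_phi, lift_gamma0Mk_phi,
      coe_fricke_smul_I, lift_gamma0Mk_mat, coe_glPos_smul, coe_I]
    push_cast
    -- With `γ` the given matrix, `r = -i γ(i)` has positive real part because `γ(i)` lies in `ℍ`.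
    set r : ℂ := -Complex.I * ((a * Complex.I + b) / (c * Complex.I + d)) with hr
    have hrq : r * (c * Complex.I + d) = a - b * Complex.I := by
      rw [hr, mul_assoc, div_mul_cancel₀ _ hcd]
      linear_combination -(a : ℂ) * Complex.I_sq
    have hq : -((k : ℂ) ^ 2 * (b : ℂ)) * (Complex.I / (k : ℂ) ^ 2) + a =
        r * (c * Complex.I + d) := by
      rw [hrq]
      field_simp
      ring
    have hrpos : 0 < r.re := by
      have h1 := ((glPos a b c d (det_pos_of_int h)) • I : ℍ).im_pos
      rw [← coe_im, coe_glPos_smul] at h1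
      rw [hr]
      simpa using h1
    have heps : eps a = eps d := by
      obtain ⟨x, rfl⟩ := hc
      exact eps_eq_of_mul_eq (x := b * x) (by linarith)
    have hd0 : d ≠ 0 := by
      rintro rfl
      obtain ⟨x, rfl⟩ := hc
      have : b * (4 * x) = 4 * (b * x) := by ring
      omega
    have hsym := extSym_fricke k hk h hc ⟨k * e, by rw [he]; ring⟩
    -- The factor `ci + d` has real part `d`, so a branch sign can occur only for `d < 0`. It is
    -- decided by the imaginary parts `c` and `-b` of `ci + d` and of the product `a - bi`. On the
    -- real axis `b = 0`, and then `ad = 1` forces `a < 0`.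
    have hsqrt : r ^ (1 / 2 : ℂ) * (c * Complex.I + d) ^ (1 / 2 : ℂ) =
        ((if d < 0 then (if (0 ≤ c ↔ b ≤ 0) then 1 else -1) else 1 : ℤ) : ℂ) *
          (r * (c * Complex.I + d)) ^ (1 / 2 : ℂ) := by
      split_ifs with h1 h2
      · rw [sqrt_mul_of_re_neg hrpos, if_pos]
        · simp
        · rw [hrq]
          simpa using h2
        · simpa using h1
        · rw [hrq]
          intro h0
          have hb : b = 0 := by simpa using h0
          subst hb
          have : a < 0 := by nlinarith
          simpa using this
      · rw [sqrt_mul_of_re_neg hrpos, if_neg]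
        · simp
        · rw [hrq]
          simpa using h2
        · simpa using h1
        · rw [hrq]
          intro h0
          have hb : b = 0 := by simpa using h0
          subst hb
          have : a < 0 := by nlinarith
          simpa using this
      · rw [sqrt_mul_of_re_pos hrpos]
        · simp
        · have : 0 < d := by omega
          simpa using this
    rw [hq, hsym, heps]
    have hs2 : ((if d < 0 then (if (0 ≤ c ↔ b ≤ 0) then 1 else -1) else 1 : ℤ) : ℂ) ^ 2 = 1 := by
      split_ifs <;> norm_num
    generalize (if d < 0 then (if (0 ≤ c ↔ b ≤ 0) then 1 else -1) else 1 : ℤ) = s at *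
    push_cast
    linear_combination (√(k : ℝ) : ℂ) * (eps d)⁻¹ * (extSym (-((k : ℤ) ^ 2 * b)) a : ℂ) *
      (s * hsqrt + (r * (c * Complex.I + d)) ^ (1 / 2 : ℂ) * hs2)

lemma IsCuspForm.slash_fricke {l k : ℕ} {f : ℍ → ℂ} (hk : 0 < k) (hk4 : 4 ∣ (k : ℤ) ^ 2)
    (hf : IsCuspForm l (k ^ 2) f) : IsCuspForm l (k ^ 2) (slash l (fricke k hk) f) := by
  refine hf.slash_of_conj _ fun g hg => ?_
  obtain ⟨a, b, c, d, h, hc, ⟨e, he⟩, rfl⟩ := exists_eq_gamma0Mk g hg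
  push_cast at he
  exact ⟨_, gamma0Mk_mem ⟨-b, by push_cast; ring⟩,
    fricke_mul_lift k hk h hc he hk4 (by rw [he] at h; linarith)⟩

/-! ### The Fricke involution and the representatives of `T(p²)` -/

section StarElements

variable (p : ℕ) [hp : Fact p.Prime]

lemma natCast_prime_pos : (0 : ℝ) < p := by exact_mod_cast hp.out.pos

lemma alphaStar_mat (b : ℕ) : (alphaStar p b).mat =
    glPos 1 b 0 ((p : ℝ) ^ 2) (by have := natCast_prime_pos p; simpa using by positivity) := rfl

lemma alphaStar_phi (b : ℕ) (z : ℍ) : (alphaStar p b).phi z = ((√(p : ℝ) : ℝ) : ℂ) := rfl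

lemma betaStar_mat (h : Finset.Ico 1 p) : (betaStar p h).mat =
    glPos p (h : ℕ) 0 p (by
      have := natCast_prime_pos p
      rw [mul_zero, sub_zero]
      positivity) := rfl

lemma betaStar_phi (h : Finset.Ico 1 p) (z : ℍ) :
    (betaStar p h).phi z = (eps p)⁻¹ * (jacobiSym (-((h : ℕ) : ℤ)) p : ℂ) := rfl

lemma sigmaStar_mat : (sigmaStar p).mat =
    glPos ((p : ℝ) ^ 2) 0 0 1 (by have := natCast_prime_pos p; simpa using by positivity) := rfl

lemma sigmaStar_phi (z : ℍ) : (sigmaStar p).phi z = (((√(p : ℝ))⁻¹ : ℝ) : ℂ) := rfl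

lemma fricke_mat (k : ℕ) (hk : 0 < k) : (fricke k hk).mat = glPos 0 (-1) ((k : ℝ) ^ 2) 0 (by
    have : (0 : ℝ) < k := by exact_mod_cast hk
    simpa using by positivity) := rfl

lemma eps_sq {n : ℕ} (hn : Odd n) : eps n ^ 2 = ((ZMod.χ₄ n : ℤ) : ℂ) := by
  rw [Nat.odd_iff] at hn
  rcases (by omega : n % 4 = 1 ∨ n % 4 = 3) with h | h
  · rw [ZMod.χ₄_nat_one_mod_four h, eps, if_pos (by omega)]
    simp
  · rw [ZMod.χ₄_nat_three_mod_four h, eps, if_neg (by omega)]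
    simp

lemma eps_ne_zero (d : ℤ) : eps d ≠ 0 := by
  rw [← norm_ne_zero_iff, norm_eps]
  exact one_ne_zero

lemma sqrt_natCast_sq (n : ℕ) : ((√(n : ℝ) : ℝ) : ℂ) ^ 2 = n := by
  exact_mod_cast Real.sq_sqrt (Nat.cast_nonneg n)

variable {p} {k : ℕ} (hk : 0 < k)

lemma fricke_mul_alphaStar_zero :
    fricke k hk * alphaStar p 0 = sigmaStar p * fricke k hk := by
  have hp0 := natCast_prime_pos p
  have hpC : (p : ℂ) ≠ 0 := by exact_mod_cast hp0.ne'
  apply Gt.ext_of_phi_I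
  · rw [Gt.mul_mat, Gt.mul_mat, fricke_mat, alphaStar_mat, sigmaStar_mat, glPos_mul, glPos_mul]
    apply glPos_congr <;> push_cast <;> ring
  · rw [Gt.mul_phi, Gt.mul_phi, fricke_phi_I, fricke_phi, alphaStar_phi, sigmaStar_phi,
      alphaStar_mat, coe_glPos_smul, coe_I]
    have h1 : -Complex.I * ((((1 : ℝ) : ℂ) * Complex.I + ((((0 : ℕ) : ℝ)) : ℂ)) /
        (((0 : ℝ) : ℂ) * Complex.I + (((p : ℝ) ^ 2 : ℝ) : ℂ))) =
          (((1 / (p : ℝ)) ^ 2 : ℝ) : ℂ) := by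
      push_cast
      field_simp
      linear_combination -(p : ℂ) ^ 2 * Complex.I_sq
    rw [h1, sqrt_ofReal (by positivity), Real.sqrt_sq (by positivity)]
    have h2 := sqrt_natCast_sq p
    have h3 : ((√(p : ℝ) : ℝ) : ℂ) ≠ 0 := by exact_mod_cast (Real.sqrt_pos.mpr hp0).ne'
    push_cast
    field_simp
    linear_combination ((√(k : ℝ) : ℝ) : ℂ) * h2

lemma fricke_mul_sigmaStar :
    fricke k hk * sigmaStar p = alphaStar p 0 * fricke k hk := by
  have hp0 := natCast_prime_pos p
  have hpC : (p : ℂ) ≠ 0 := by exact_mod_cast hp0.ne'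
  apply Gt.ext_of_phi_I
  · rw [Gt.mul_mat, Gt.mul_mat, fricke_mat, alphaStar_mat, sigmaStar_mat, glPos_mul, glPos_mul]
    apply glPos_congr <;> push_cast <;> ring
  · rw [Gt.mul_phi, Gt.mul_phi, fricke_phi_I, fricke_phi, alphaStar_phi, sigmaStar_phi,
      sigmaStar_mat, coe_glPos_smul, coe_I]
    have h1 : -Complex.I * (((((p : ℝ) ^ 2 : ℝ) : ℂ) * Complex.I + ((0 : ℝ) : ℂ)) /
        (((0 : ℝ) : ℂ) * Complex.I + ((1 : ℝ) : ℂ))) = (((p : ℝ) ^ 2 : ℝ) : ℂ) := by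
      push_cast
      field_simp
      linear_combination -(p : ℂ) ^ 2 * Complex.I_sq
    rw [h1, sqrt_ofReal (by positivity), Real.sqrt_sq (by positivity)]
    have h2 := sqrt_natCast_sq p
    have h3 : ((√(p : ℝ) : ℝ) : ℂ) ≠ 0 := by exact_mod_cast (Real.sqrt_pos.mpr hp0).ne'
    push_cast
    field_simp
    linear_combination -((√(k : ℝ) : ℝ) : ℂ) * h2

/-- The diagonal entries are positive, so the correction sign in `jacobiSym_gamma0` is absent. -/
lemma extSym_fricke_of_pos {a b e D : ℤ} {n : ℕ} (ha : a = n) (hn : 0 < n)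
    (h : a * D - (-b) * (-((k : ℤ) ^ 2 * e)) = 1)
    (hk4 : 4 ∣ (k : ℤ) ^ 2) (hD : 0 < D) :
    extSym (-((k : ℤ) ^ 2 * e)) D = jacobiSym b n := by
  rw [extSym, if_neg (by omega), jacobiSym_gamma0 h ((hk4.mul_right e).neg_right), neg_neg,
    if_neg, mul_one, ha, Int.natAbs_natCast]
  have : 0 < a * D := mul_pos (by omega) hD
  omega

/-- The pairing is `k² b b' ≡ -1 (mod p²)`, which makes the lower right entry `D` integral. The lift
contributes no constant: its symbol is `(b'/p²) = 1`, and `p² D ≡ 1 (mod 4)` gives `ε_D = 1`. -/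
lemma fricke_mul_alphaStar_of_coprime (hk4 : 4 ∣ (k : ℤ) ^ 2) (hp2 : p ≠ 2) {b b' : ℕ} {D : ℤ}
    (hb' : IsCoprime (b' : ℤ) p) (hD : (p : ℤ) ^ 2 * D = (k : ℤ) ^ 2 * b * b' + 1)
    (h : (p : ℤ) ^ 2 * D - (-(b' : ℤ)) * (-((k : ℤ) ^ 2 * b)) = 1) :
    fricke k hk * alphaStar p b =
      lift (gamma0Mk ((p : ℤ) ^ 2) (-(b' : ℤ)) (-((k : ℤ) ^ 2 * b)) D h
        ((hk4.mul_right _).neg_right)) * alphaStar p b' * fricke k hk := by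
  have hp0 := natCast_prime_pos p
  have hpC : (p : ℂ) ≠ 0 := by exact_mod_cast hp0.ne'
  have hkC : (k : ℂ) ≠ 0 := by exact_mod_cast hk.ne'
  have hDR : (p : ℝ) ^ 2 * D = (k : ℝ) ^ 2 * b * b' + 1 := by exact_mod_cast hD
  have hDC : (p : ℂ) ^ 2 * D = (k : ℂ) ^ 2 * b * b' + 1 := by exact_mod_cast hD
  have hDpos : 0 < D := by
    have h1 : 0 < (p : ℤ) ^ 2 * D := by rw [hD]; positivity
    exact pos_of_mul_pos_right h1 (by positivity)
  have hpodd : Odd p := hp.out.odd_of_ne_two hp2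
  apply Gt.ext_of_phi_I
  · rw [Gt.mul_mat, Gt.mul_mat, Gt.mul_mat, lift_gamma0Mk_mat, fricke_mat, alphaStar_mat,
      alphaStar_mat, glPos_mul, glPos_mul, glPos_mul]
    apply glPos_congr <;> push_cast
    · ring
    · ring
    · linear_combination -(k : ℝ) ^ 2 * hDR
    · ring
  · rw [Gt.mul_phi, Gt.mul_phi, Gt.mul_phi, fricke_phi_I, fricke_phi, alphaStar_phi,
      alphaStar_phi, lift_gamma0Mk_phi, alphaStar_mat, alphaStar_mat, coe_glPos_smul,
      coe_glPos_smul, coe_fricke_smul_I, coe_I]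
    have hsym : extSym (-((k : ℤ) ^ 2 * b)) D = 1 := by
      rw [extSym_fricke_of_pos (a := (p : ℤ) ^ 2) (n := p ^ 2) (by push_cast; ring)
        (pow_pos hp.out.pos 2) h hk4 hDpos, jacobiSym.pow_right]
      exact jacobiSym.sq_one (Int.isCoprime_iff_gcd_eq_one.mp hb')
    have heps : eps D = 1 := by
      rw [eps, if_pos]
      obtain ⟨x, hx⟩ := hk4
      rw [hx] at hD
      have h1 : (p : ℤ) ^ 2 % 4 = 1 := Int.sq_mod_four_eq_one_of_odd (by exact_mod_cast hpodd)
      have h2 : ((p : ℤ) ^ 2 * D) % 4 = 1 := by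
        rw [hD, show 4 * x * b * b' + 1 = 4 * (x * b * b') + 1 by ring]
        omega
      rw [Int.mul_emod, h1] at h2
      omega
    rw [hsym, heps]
    have harg : (((-((k : ℤ) ^ 2 * b) : ℤ) : ℂ)) * ((((1 : ℝ) : ℂ) * (Complex.I / (k : ℂ) ^ 2) +
        (((b' : ℕ) : ℝ) : ℂ)) / (((0 : ℝ) : ℂ) * (Complex.I / (k : ℂ) ^ 2) +
          (((p : ℝ) ^ 2 : ℝ) : ℂ))) + D =
        -Complex.I * ((((1 : ℝ) : ℂ) * Complex.I + (((b : ℕ) : ℝ) : ℂ)) /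
          (((0 : ℝ) : ℂ) * Complex.I + (((p : ℝ) ^ 2 : ℝ) : ℂ))) := by
      push_cast
      rw [zero_mul, zero_mul, zero_add]
      field_simp
      linear_combination hDC + Complex.I_sq
    rw [harg]
    push_cast
    ring

lemma jacobiSym_mul_neg_self {h : ℤ} {n : ℕ} (hn : Odd n) (hh : IsCoprime h n) :
    jacobiSym h n * jacobiSym (-h) n = ZMod.χ₄ n := by
  rw [jacobiSym.neg _ hn, mul_left_comm, ← sq,
    jacobiSym.sq_one (Int.isCoprime_iff_gcd_eq_one.mp hh), mul_one]

lemma isCoprime_of_mem_Ico (h : Finset.Ico 1 p) : IsCoprime ((h : ℕ) : ℤ) p := by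
  have hh := Finset.mem_Ico.mp h.2
  exact Nat.isCoprime_iff_coprime.mpr (Nat.coprime_of_lt_prime (by omega) hh.2 hp.out).symm

/-- From `k² h b ≡ -1 (mod p)` the symbol `(b/p)` of the lift equals the `(-h/p)` of `betaStar`; the
factor `p^{1/2}` of `alphaStar` comes out of the square root. -/
lemma fricke_mul_betaStar (hk4 : 4 ∣ (k : ℤ) ^ 2) (hp2 : p ≠ 2) {b h : Finset.Ico 1 p} {D : ℤ}
    (hD : (p : ℤ) * D = (k : ℤ) ^ 2 * (h : ℕ) * (b : ℕ) + 1)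
    (h1 : (p : ℤ) * D - (-((b : ℕ) : ℤ)) * (-((k : ℤ) ^ 2 * (h : ℕ))) = 1) :
    fricke k hk * betaStar p h =
      lift (gamma0Mk p (-((b : ℕ) : ℤ)) (-((k : ℤ) ^ 2 * (h : ℕ))) D h1
        ((hk4.mul_right _).neg_right)) * alphaStar p (p * b) * fricke k hk := by
  have hp0 := natCast_prime_pos p
  have hpC : (p : ℂ) ≠ 0 := by exact_mod_cast hp0.ne'
  have hkC : (k : ℂ) ≠ 0 := by exact_mod_cast hk.ne'
  have hDR : (p : ℝ) * D = (k : ℝ) ^ 2 * (h : ℕ) * (b : ℕ) + 1 := by exact_mod_cast hD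
  have hDC : (p : ℂ) * D = (k : ℂ) ^ 2 * (h : ℕ) * (b : ℕ) + 1 := by exact_mod_cast hD
  have hDpos : 0 < D := by
    have h1 : 0 < (p : ℤ) * D := by rw [hD]; positivity
    exact pos_of_mul_pos_right h1 (by positivity)
  have hpodd : Odd p := hp.out.odd_of_ne_two hp2
  apply Gt.ext_of_phi_I
  · rw [Gt.mul_mat, Gt.mul_mat, Gt.mul_mat, lift_gamma0Mk_mat, fricke_mat, alphaStar_mat,
      betaStar_mat, glPos_mul, glPos_mul, glPos_mul]
    apply glPos_congr <;> push_cast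
    · ring
    · ring
    · linear_combination -(k : ℝ) ^ 2 * p * hDR
    · ring
  · rw [Gt.mul_phi, Gt.mul_phi, Gt.mul_phi, fricke_phi_I, fricke_phi, alphaStar_phi,
      betaStar_phi, lift_gamma0Mk_phi, alphaStar_mat, betaStar_mat, coe_glPos_smul,
      coe_glPos_smul, coe_fricke_smul_I, coe_I]
    have hsym : extSym (-((k : ℤ) ^ 2 * (h : ℕ))) D = jacobiSym (-((h : ℕ) : ℤ)) p := by
      rw [extSym_fricke_of_pos (a := (p : ℤ)) (n := p) rfl hp.out.pos h1 hk4 hDpos]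
      apply Int.eq_of_mul_eq_one
      rw [← jacobiSym.mul_left]
      have hcop : IsCoprime (k : ℤ) p := ⟨-(k * (h : ℕ) * (b : ℕ)), D, by linarith⟩
      rw [← jacobiSym_sq_mul k _ _ hcop, ← jacobiSym.one_left p]
      apply jacobiSym.mod_left'
      rw [Int.emod_eq_emod_iff_emod_sub_eq_zero]
      exact Int.emod_eq_zero_of_dvd ⟨-D, by linarith⟩
    have heps : eps p = eps D := by
      obtain ⟨x, hx⟩ := hk4
      exact eps_eq_of_mul_eq (x := x * (h : ℕ) * (b : ℕ)) (by rw [hD, hx]; ring)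
    rw [hsym, heps]
    have harg : -Complex.I * ((((p : ℝ) : ℂ) * Complex.I + (((h : ℕ) : ℝ) : ℂ)) /
          (((0 : ℝ) : ℂ) * Complex.I + ((p : ℝ) : ℂ))) =
        ((p : ℝ) : ℂ) * ((((-((k : ℤ) ^ 2 * (h : ℕ)) : ℤ) : ℂ)) *
          ((((1 : ℝ) : ℂ) * (Complex.I / (k : ℂ) ^ 2) +
        (((p * b : ℕ) : ℝ) : ℂ)) / (((0 : ℝ) : ℂ) * (Complex.I / (k : ℂ) ^ 2) +
          (((p : ℝ) ^ 2 : ℝ) : ℂ))) + D) := by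
      push_cast
      rw [zero_mul, zero_mul, zero_add]
      field_simp
      linear_combination -(p : ℂ) ^ 3 * hDC - (p : ℂ) ^ 3 * Complex.I_sq
    rw [harg, sqrt_ofReal_mul hp0]
    ring

/-- The constants of the lift and of `betaStar` multiply to `ε_p⁻² (h/p)(-h/p) = 1`, since `ε_p² =
(-1/p)`. -/
lemma fricke_mul_alphaStar_mul (hk4 : 4 ∣ (k : ℤ) ^ 2) (hp2 : p ≠ 2) {b h : Finset.Ico 1 p} {D : ℤ}
    (hD : (p : ℤ) * D = (k : ℤ) ^ 2 * (b : ℕ) * (h : ℕ) + 1)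
    (h1 : (p : ℤ) * D - (-((h : ℕ) : ℤ)) * (-((k : ℤ) ^ 2 * (b : ℕ))) = 1) :
    fricke k hk * alphaStar p (p * b) =
      lift (gamma0Mk p (-((h : ℕ) : ℤ)) (-((k : ℤ) ^ 2 * (b : ℕ))) D h1
        ((hk4.mul_right _).neg_right)) * betaStar p h * fricke k hk := by
  have hp0 := natCast_prime_pos p
  have hpC : (p : ℂ) ≠ 0 := by exact_mod_cast hp0.ne'
  have hkC : (k : ℂ) ≠ 0 := by exact_mod_cast hk.ne'
  have hDR : (p : ℝ) * D = (k : ℝ) ^ 2 * (b : ℕ) * (h : ℕ) + 1 := by exact_mod_cast hD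
  have hDC : (p : ℂ) * D = (k : ℂ) ^ 2 * (b : ℕ) * (h : ℕ) + 1 := by exact_mod_cast hD
  have hDpos : 0 < D := by
    have h1 : 0 < (p : ℤ) * D := by rw [hD]; positivity
    exact pos_of_mul_pos_right h1 (by positivity)
  have hpodd : Odd p := hp.out.odd_of_ne_two hp2
  apply Gt.ext_of_phi_I
  · rw [Gt.mul_mat, Gt.mul_mat, Gt.mul_mat, lift_gamma0Mk_mat, fricke_mat, alphaStar_mat,
      betaStar_mat, glPos_mul, glPos_mul, glPos_mul]
    apply glPos_congr <;> push_cast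
    · ring
    · ring
    · linear_combination -(k : ℝ) ^ 2 * hDR
    · ring
  · rw [Gt.mul_phi, Gt.mul_phi, Gt.mul_phi, fricke_phi_I, fricke_phi, alphaStar_phi,
      betaStar_phi, lift_gamma0Mk_phi, alphaStar_mat, betaStar_mat, coe_glPos_smul,
      coe_glPos_smul, coe_fricke_smul_I, coe_I]
    have hsym := extSym_fricke_of_pos (k := k) (a := (p : ℤ)) (n := p) rfl hp.out.pos h1 hk4 hDpos
    have heps : eps p = eps D := by
      obtain ⟨x, hx⟩ := hk4
      exact eps_eq_of_mul_eq (x := x * (b : ℕ) * (h : ℕ)) (by rw [hD, hx]; ring)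
    rw [hsym, ← heps]
    have harg : (((-((k : ℤ) ^ 2 * (b : ℕ)) : ℤ) : ℂ)) *
          ((((p : ℝ) : ℂ) * (Complex.I / (k : ℂ) ^ 2) +
        (((h : ℕ) : ℝ) : ℂ)) / (((0 : ℝ) : ℂ) * (Complex.I / (k : ℂ) ^ 2) +
          ((p : ℝ) : ℂ))) + D = ((p : ℝ) : ℂ) *
        (-Complex.I * ((((1 : ℝ) : ℂ) * Complex.I + (((p * b : ℕ) : ℝ) : ℂ)) /
          (((0 : ℝ) : ℂ) * Complex.I + (((p : ℝ) ^ 2 : ℝ) : ℂ)))) := by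
      push_cast
      rw [zero_mul, zero_mul, zero_add]
      field_simp
      linear_combination (p : ℂ) ^ 2 * hDC + (p : ℂ) ^ 2 * Complex.I_sq
    have hconst : (eps p)⁻¹ * (jacobiSym (h : ℕ) p : ℂ) *
        ((eps p)⁻¹ * (jacobiSym (-((h : ℕ) : ℤ)) p : ℂ)) = 1 := by
      have h2 : ((jacobiSym (h : ℕ) p : ℤ) : ℂ) * (jacobiSym (-((h : ℕ) : ℤ)) p : ℂ) =
          eps p ^ 2 := by
        rw [eps_sq hpodd, ← jacobiSym_mul_neg_self hpodd (isCoprime_of_mem_Ico h)]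
        push_cast
        rfl
      have h3 := eps_ne_zero p
      field_simp
      exact h2
    rw [harg, sqrt_ofReal_mul hp0]
    linear_combination -((√(k : ℝ) : ℝ) : ℂ) * ((√(p : ℝ) : ℝ) : ℂ) *
      (-Complex.I * ((((1 : ℝ) : ℂ) * Complex.I + (((p * b : ℕ) : ℝ) : ℂ)) /
        (((0 : ℝ) : ℂ) * Complex.I + (((p : ℝ) ^ 2 : ℝ) : ℂ)))) ^ (1 / 2 : ℂ) * hconst

end StarElements

/-! ### Translation by one half at level 16 -/

/-- The translation `((1 1/2; 0 1), 1)` by one half. -/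
def halfShift : Gt := upper 1 (1 / 2) 1 1 one_pos one_pos (by simp)

lemma halfShift_mat : halfShift.mat = glPos 1 (1 / 2) 0 1 (by norm_num) := rfl

lemma halfShift_phi (z : ℍ) : halfShift.phi z = 1 := rfl

/-- Removing the square 16 lowers the period in `d` from `64x` to `4x`, which divides the shift `8x`
occurring below. -/
lemma extSym_sixteen_mul (x : ℤ) {d : ℤ} (hd : Odd d) : extSym (16 * x) d = extSym x d := by
  have h1 : jacobiSym (16 * x) d.natAbs = jacobiSym x d.natAbs := by
    have hcop : IsCoprime ((4 : ℕ) : ℤ) (d.natAbs : ℤ) := by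
      rw [Nat.isCoprime_iff_coprime]
      exact (Nat.Coprime.pow_left 2 (Nat.coprime_two_left.mpr (Int.natAbs_odd.mpr hd)) :)
    exact jacobiSym_sq_mul 4 x _ hcop
  unfold extSym
  rw [h1]
  split_ifs <;> first | (exfalso; omega) | rfl

/-- Conjugation moves the diagonal entries by `±c/2 = ±8x` and adds `(d - a)/2 - c/4` to `b`, an
integer since `a` and `d` are odd. A shift of `d` by `8x` changes neither `ε_d` nor `(x/d)`. -/
lemma halfShift_mul_lift {a b x d e : ℤ} (h : a * d - b * (16 * x) = 1) (hc : 4 ∣ 16 * x)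
    (hd : d = a + 2 * e)
    (h' : (a + 8 * x) * (d - 8 * x) - (b + e - 4 * x) * (16 * x) = 1) :
    halfShift * lift (gamma0Mk a b (16 * x) d h hc) =
      lift (gamma0Mk (a + 8 * x) (b + e - 4 * x) (16 * x) (d - 8 * x) h' hc) * halfShift := by
  have hdR : (d : ℝ) = a + 2 * e := by exact_mod_cast hd
  have hodd : Odd d := by
    rw [← Int.not_even_iff_odd]
    rintro ⟨y, rfl⟩
    have : a * (y + y) - b * (16 * x) = 2 * (a * y - 8 * b * x) := by ring
    omega
  apply Gt.ext_of_phi_I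
  · rw [Gt.mul_mat, Gt.mul_mat, lift_gamma0Mk_mat, lift_gamma0Mk_mat, halfShift_mat, glPos_mul,
      glPos_mul]
    apply glPos_congr <;> push_cast
    · ring
    · linear_combination (1 / 2 : ℝ) * hdR
    · ring
    · ring
  · rw [Gt.mul_phi, Gt.mul_phi, halfShift_phi, halfShift_phi, lift_gamma0Mk_phi,
      lift_gamma0Mk_phi, halfShift_mat, coe_glPos_smul, coe_I]
    have hodd' : Odd (d - 8 * x) := hodd.sub_even ⟨4 * x, by ring⟩
    rw [extSym_sixteen_mul x hodd, extSym_sixteen_mul x hodd',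
      extSym_congr_right hodd (show 4 * x ∣ d - (d - 8 * x) from ⟨2, by ring⟩),
      eps_congr (show d % 4 = (d - 8 * x) % 4 by omega), one_mul, mul_one]
    congr 2
    push_cast
    ring

lemma IsCuspForm.slash_halfShift {l : ℕ} {f : ℍ → ℂ} (hf : IsCuspForm l 16 f) :
    IsCuspForm l 16 (slash l halfShift f) := by
  refine hf.slash_of_conj _ fun g hg => ?_
  obtain ⟨a, b, c, d, h, hc, ⟨x, rfl⟩, rfl⟩ := exists_eq_gamma0Mk g hg
  push_cast at h hc ⊢
  obtain ⟨e, he⟩ : ∃ e, d = a + 2 * e := by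
    have h1 : a * d = 2 * (8 * b * x) + 1 := by linarith
    have h2 : Odd (a * d) := ⟨_, h1⟩
    rw [Int.odd_mul, Int.odd_iff, Int.odd_iff] at h2
    exact ⟨(d - a) / 2, by omega⟩
  refine ⟨_, gamma0Mk_mem ⟨x, by push_cast; ring⟩, halfShift_mul_lift h hc he ?_⟩
  subst he
  linarith

lemma IsCuspForm.slash_lift_mul {l N : ℕ} {f : ℍ → ℂ} (hf : IsCuspForm l N f) (x : Gt)
    {a b c d : ℤ} (h : a * d - b * c = 1) (hc : 4 ∣ c) (hN : (N : ℤ) ∣ c) :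
    slash l (lift (gamma0Mk a b c d h hc) * x) f = slash l x f := by
  rw [slash_mul, hf.slash_eq _ (gamma0Mk_mem hN)]

/-! ### Compatibility with the Hecke operator -/

section Hecke

variable {p : ℕ} [hp : Fact p.Prime]

/-- If slashing with `ρ` commutes with the sum over the coset representatives defining `T(p²)`,
then it preserves the eigenvalue equation. -/
lemma heckeT_slash {l : ℕ} {f : ℍ → ℂ} {ω : ℂ} (ρ : Gt) (hf : ∀ z, heckeT p l f z = ω * f z)
    (h : ∀ z, ∑ b ∈ Finset.range (p ^ 2), slash l (ρ * alphaStar p b) f z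
        + ∑ h : Finset.Ico 1 p, slash l (ρ * betaStar p h) f z + slash l (ρ * sigmaStar p) f z =
      ∑ b ∈ Finset.range (p ^ 2), slash l (alphaStar p b * ρ) f z
        + ∑ h : Finset.Ico 1 p, slash l (betaStar p h * ρ) f z + slash l (sigmaStar p * ρ) f z)
    (z : ℍ) : heckeT p l (slash l ρ f) z = ω * slash l ρ f z := by
  have h1 := h z
  simp only [slash_mul] at h1
  rw [heckeT, h1]
  have h2 : slash l ρ (heckeT p l f) z = ω * slash l ρ f z := by
    rw [funext hf, slash_const_mul]
  rw [← h2]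
  simp only [slash, heckeT, Finset.mul_sum, mul_add]
  ring_nf

/-- A symmetric relation that is total and single-valued on `S` is the graph of an involution, along
which the sum is reindexed. -/
lemma sum_eq_sum_of_symm_rel {ι : Type*} (S : Finset ι) (R : ι → ι → Prop) (F G : ι → ℂ)
    (hsymm : ∀ a b, R a b → R b a) (hex : ∀ a ∈ S, ∃ b ∈ S, R a b)
    (huniq : ∀ a ∈ S, ∀ b ∈ S, ∀ c ∈ S, R a b → R a c → b = c)
    (hFG : ∀ a ∈ S, ∀ b ∈ S, R a b → F a = G b) : ∑ a ∈ S, F a = ∑ a ∈ S, G a := by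
  classical
  choose! φ hS hR using hex
  have hinv : ∀ a ∈ S, φ (φ a) = a := fun a ha =>
    huniq (φ a) (hS a ha) _ (hS _ (hS a ha)) _ ha (hR _ (hS a ha)) (hsymm _ _ (hR a ha))
  exact Finset.sum_nbij' φ φ hS hS hinv hinv fun a ha => hFG a ha _ (hS a ha) (hR a ha)

/-- This splitting separates the three behaviours under Fricke: units, nonzero multiples of `p`, and
`0`. -/
lemma sum_range_sq (u : ℕ → ℂ) : ∑ b ∈ Finset.range (p ^ 2), u b =
    ∑ b ∈ (Finset.range (p ^ 2)).filter (fun b => ¬ p ∣ b), u b +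
      ∑ h : Finset.Ico 1 p, u (p * (h : ℕ)) + u 0 := by
  have hp0 := hp.out.pos
  rw [← Finset.sum_filter_add_sum_filter_not (Finset.range (p ^ 2)) (fun b => ¬ p ∣ b), add_assoc]
  congr 1
  simp only [not_not]
  have h1 : (Finset.range (p ^ 2)).filter (fun b => p ∣ b) =
      (Finset.range p).image (fun h => p * h) := by
    ext b
    simp only [Finset.mem_filter, Finset.mem_range, Finset.mem_image]
    constructor
    · rintro ⟨hb, c, rfl⟩
      exact ⟨c, by nlinarith, rfl⟩
    · rintro ⟨c, hc, rfl⟩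
      exact ⟨by nlinarith, dvd_mul_right _ _⟩
  rw [h1, Finset.sum_image (fun a _ b _ hab => Nat.eq_of_mul_eq_mul_left hp0 hab),
    Finset.range_eq_Ico, Finset.sum_eq_sum_Ico_succ_bot hp0, mul_zero, add_comm, zero_add,
    ← Finset.sum_coe_sort (Finset.Ico 1 p) (fun h => u (p * h))]

/-- Solvability and uniqueness of `c b b' ≡ -1` modulo `m`. -/
lemma exists_lt_dvd_mul_add_one {c b : ℤ} {m : ℕ} (hm : 0 < m) (h : IsCoprime (c * b) m) :
    ∃ b' : ℕ, b' < m ∧ (m : ℤ) ∣ c * b * b' + 1 := by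
  obtain ⟨u, v, huv⟩ := h
  have hm' : (0 : ℤ) < m := by exact_mod_cast hm
  have h0 := Int.emod_nonneg (-u) hm'.ne'
  have h1 := Int.emod_lt_of_pos (-u) hm'
  refine ⟨((-u) % m).toNat, by omega, ?_⟩
  rw [Int.toNat_of_nonneg h0]
  have h2 := Int.emod_add_mul_ediv (-u) m
  have h3 : (-u) % m = -u - m * (-u / m) := by linarith
  rw [h3]
  exact ⟨v - c * b * (-u / m), by linear_combination (1 : ℤ) * (-huv)⟩

lemma eq_of_dvd_mul_add_one {c b : ℤ} {m x y : ℕ} (hx : x < m) (hy : y < m)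
    (h1 : (m : ℤ) ∣ c * b * x + 1) (h2 : (m : ℤ) ∣ c * b * y + 1) : x = y := by
  have hcop : IsCoprime (m : ℤ) (c * b) := by
    obtain ⟨e, he⟩ := h1
    exact ⟨e, -x, by linarith⟩
  have h3 : (m : ℤ) ∣ c * b * ((x : ℤ) - y) := by
    obtain ⟨u, hu⟩ := h1
    obtain ⟨v, hv⟩ := h2
    exact ⟨u - v, by linear_combination hu - hv⟩
  have h4 := hcop.dvd_of_dvd_mul_left h3
  have h5 := Int.eq_zero_of_abs_lt_dvd h4 (by rw [abs_lt]; constructor <;> omega)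
  omega

/-- Modulo lifts, Fricke permutes the `alphaStar p b` with `b` prime to `p`, exchanges the
`alphaStar p (p * b)` with the `betaStar p h`, and exchanges `alphaStar p 0` with `sigmaStar p`. -/
lemma IsCuspForm.hecke_sum_fricke {l k : ℕ} {f : ℍ → ℂ} (hk : 0 < k) (hk4 : 4 ∣ (k : ℤ) ^ 2)
    (hp2 : p ≠ 2) (hkp : IsCoprime (k : ℤ) p) (hf : IsCuspForm l (k ^ 2) f) (z : ℍ) :
    ∑ b ∈ Finset.range (p ^ 2), slash l (fricke k hk * alphaStar p b) f z
        + ∑ h : Finset.Ico 1 p, slash l (fricke k hk * betaStar p h) f z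
        + slash l (fricke k hk * sigmaStar p) f z =
      ∑ b ∈ Finset.range (p ^ 2), slash l (alphaStar p b * fricke k hk) f z
        + ∑ h : Finset.Ico 1 p, slash l (betaStar p h * fricke k hk) f z
        + slash l (sigmaStar p * fricke k hk) f z := by
  have hp0 := hp.out.pos
  have hN : ∀ x : ℤ, ((k ^ 2 : ℕ) : ℤ) ∣ -((k : ℤ) ^ 2 * x) := fun x =>
    ⟨-x, by push_cast; ring⟩
  have hcopp : ∀ b : ℕ, ¬ p ∣ b → IsCoprime (b : ℤ) p := fun b hb =>
    Nat.isCoprime_iff_coprime.mpr ((Nat.Prime.coprime_iff_not_dvd hp.out).mpr hb).symm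
  have hunits : ∑ b ∈ (Finset.range (p ^ 2)).filter (fun b => ¬ p ∣ b),
        slash l (fricke k hk * alphaStar p b) f z =
      ∑ b ∈ (Finset.range (p ^ 2)).filter (fun b => ¬ p ∣ b),
        slash l (alphaStar p b * fricke k hk) f z := by
    apply sum_eq_sum_of_symm_rel _ fun b b' : ℕ => ((p ^ 2 : ℕ) : ℤ) ∣ (k : ℤ) ^ 2 * b * b' + 1
    · intro a b h
      rwa [mul_right_comm] at h
    · intro b hb
      rw [Finset.mem_filter, Finset.mem_range] at hb
      obtain ⟨b', hlt, hd⟩ := exists_lt_dvd_mul_add_one (c := (k : ℤ) ^ 2) (b := b)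
        (m := p ^ 2) (by positivity) (by
          push_cast
          exact ((hkp.pow_left).mul_left (hcopp b hb.2)).pow_right)
      refine ⟨b', ?_, hd⟩
      rw [Finset.mem_filter, Finset.mem_range]
      refine ⟨hlt, fun hdvd => ?_⟩
      have h1 : (p : ℤ) ∣ (k : ℤ) ^ 2 * b * b' + 1 :=
        (Dvd.intro (p : ℤ) (by push_cast; ring)).trans hd
      have h2 : (p : ℤ) ∣ (k : ℤ) ^ 2 * b * b' := (Int.natCast_dvd_natCast.mpr hdvd).mul_left _
      have h3 : (p : ℤ) ∣ 1 := (dvd_add_right h2).mp h1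
      exact hp.out.one_lt.ne' (by exact_mod_cast Int.eq_one_of_dvd_one (by positivity) h3)
    · intro a _ b hb c hc h1 h2
      rw [Finset.mem_filter, Finset.mem_range] at hb hc
      exact eq_of_dvd_mul_add_one hb.1 hc.1 h1 h2
    · intro b _ b' hb' ⟨D, hD⟩
      rw [Finset.mem_filter] at hb'
      push_cast at hD
      rw [fricke_mul_alphaStar_of_coprime hk hk4 hp2 (hcopp b' hb'.2) hD.symm
        (by linarith), mul_assoc, hf.slash_lift_mul _ _ _ (hN _)]
  have hrel : ∀ F G : Finset.Ico 1 p → ℂ,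
      (∀ a b : Finset.Ico 1 p, ∀ D : ℤ, (p : ℤ) * D = (k : ℤ) ^ 2 * (a : ℕ) * (b : ℕ) + 1 →
        F a = G b) → ∑ a, F a = ∑ a, G a := by
    intro F G hFG
    apply sum_eq_sum_of_symm_rel _
      fun b b' : Finset.Ico 1 p => (p : ℤ) ∣ (k : ℤ) ^ 2 * (b : ℕ) * (b' : ℕ) + 1
    · intro a b h
      rwa [mul_right_comm] at h
    · intro b _
      obtain ⟨b', hlt, hd⟩ := exists_lt_dvd_mul_add_one (c := (k : ℤ) ^ 2) (b := ((b : ℕ) : ℤ))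
        (m := p) hp0 ((hkp.pow_left).mul_left (isCoprime_of_mem_Ico b))
      refine ⟨⟨b', Finset.mem_Ico.mpr ⟨?_, hlt⟩⟩, Finset.mem_univ _, hd⟩
      rw [Nat.one_le_iff_ne_zero]
      rintro rfl
      rw [Nat.cast_zero, mul_zero, zero_add] at hd
      exact hp.out.one_lt.ne' (by exact_mod_cast Int.eq_one_of_dvd_one (by positivity) hd)
    · intro a _ b _ c _ h1 h2
      exact Subtype.ext (eq_of_dvd_mul_add_one (Finset.mem_Ico.mp b.2).2
        (Finset.mem_Ico.mp c.2).2 h1 h2)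
    · intro a _ b _ ⟨D, hD⟩
      exact hFG a b D hD.symm
  have hab : ∑ h : Finset.Ico 1 p, slash l (fricke k hk * alphaStar p (p * h)) f z =
      ∑ h : Finset.Ico 1 p, slash l (betaStar p h * fricke k hk) f z :=
    hrel _ _ fun b h D hD => by
      rw [fricke_mul_alphaStar_mul hk hk4 hp2 hD (by linarith), mul_assoc,
        hf.slash_lift_mul _ _ _ (hN _)]
  have hba : ∑ h : Finset.Ico 1 p, slash l (fricke k hk * betaStar p h) f z =
      ∑ h : Finset.Ico 1 p, slash l (alphaStar p (p * h) * fricke k hk) f z :=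
    hrel _ _ fun h b D hD => by
      rw [fricke_mul_betaStar hk hk4 hp2 hD (by linarith), mul_assoc,
        hf.slash_lift_mul _ _ _ (hN _)]
  rw [sum_range_sq, sum_range_sq (fun b => slash l (alphaStar p b * fricke k hk) f z), hunits, hab,
    hba, fricke_mul_alphaStar_zero, fricke_mul_sigmaStar]
  ring

/-- Passing the half translation across multiplies it by `p²`: since `p²/2 = s + 1/2`, it leaves an
integral shift `s`, reduced modulo `p²` at the cost of an integral translation on the left. -/
lemma halfShift_mul_alphaStar (b b' n s : ℕ) (hs : p ^ 2 = 2 * s + 1)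
    (hb : b + s = b' + p ^ 2 * n) :
    halfShift * alphaStar p b =
      lift (gamma0Mk 1 n 0 1 (by ring) (dvd_zero 4)) * alphaStar p b' * halfShift := by
  have hsR : (p : ℝ) ^ 2 = 2 * s + 1 := by exact_mod_cast hs
  have hbR : (b : ℝ) + s = b' + (p : ℝ) ^ 2 * n := by exact_mod_cast hb
  apply Gt.ext_of_phi_I
  · rw [Gt.mul_mat, Gt.mul_mat, Gt.mul_mat, lift_gamma0Mk_mat, halfShift_mat, alphaStar_mat,
      alphaStar_mat, glPos_mul, glPos_mul, glPos_mul]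
    apply glPos_congr <;> push_cast
    · ring
    · linear_combination hbR + (1 / 2 : ℝ) * hsR
    · ring
    · ring
  · rw [Gt.mul_phi, Gt.mul_phi, Gt.mul_phi, alphaStar_phi, alphaStar_phi, halfShift_phi,
      halfShift_phi, lift_gamma0Mk_phi]
    simp [eps, extSym]

lemma halfShift_mul_betaStar (h : Finset.Ico 1 p) :
    halfShift * betaStar p h = betaStar p h * halfShift := by
  apply Gt.ext_of_phi_I
  · rw [Gt.mul_mat, Gt.mul_mat, halfShift_mat, betaStar_mat, glPos_mul, glPos_mul]
    apply glPos_congr <;> ring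
  · rw [Gt.mul_phi, Gt.mul_phi, betaStar_phi, betaStar_phi, halfShift_phi, halfShift_phi]
    ring

lemma halfShift_mul_sigmaStar (s : ℕ) (hs : p ^ 2 = 2 * s + 1) :
    halfShift * sigmaStar p =
      lift (gamma0Mk 1 (-s) 0 1 (by ring) (dvd_zero 4)) * sigmaStar p * halfShift := by
  have hsR : (p : ℝ) ^ 2 = 2 * s + 1 := by exact_mod_cast hs
  apply Gt.ext_of_phi_I
  · rw [Gt.mul_mat, Gt.mul_mat, Gt.mul_mat, lift_gamma0Mk_mat, halfShift_mat, sigmaStar_mat,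
      glPos_mul, glPos_mul, glPos_mul]
    apply glPos_congr <;> push_cast
    · ring
    · linear_combination (-1 / 2 : ℝ) * hsR
    · ring
    · ring
  · rw [Gt.mul_phi, Gt.mul_phi, Gt.mul_phi, sigmaStar_phi, sigmaStar_phi, halfShift_phi,
      halfShift_phi, lift_gamma0Mk_phi]
    simp [eps, extSym]

lemma IsCuspForm.hecke_sum_halfShift {l N : ℕ} {f : ℍ → ℂ} (hp2 : p ≠ 2)
    (hf : IsCuspForm l N f) (z : ℍ) :
    ∑ b ∈ Finset.range (p ^ 2), slash l (halfShift * alphaStar p b) f z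
        + ∑ h : Finset.Ico 1 p, slash l (halfShift * betaStar p h) f z
        + slash l (halfShift * sigmaStar p) f z =
      ∑ b ∈ Finset.range (p ^ 2), slash l (alphaStar p b * halfShift) f z
        + ∑ h : Finset.Ico 1 p, slash l (betaStar p h * halfShift) f z
        + slash l (sigmaStar p * halfShift) f z := by
  have hpos : 0 < p ^ 2 := pow_pos hp.out.pos 2
  obtain ⟨s, hs⟩ := (hp.out.odd_of_ne_two hp2).pow (n := 2)
  have hsum : ∑ b ∈ Finset.range (p ^ 2), slash l (halfShift * alphaStar p b) f z =
      ∑ b ∈ Finset.range (p ^ 2), slash l (alphaStar p b * halfShift) f z := by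
    have hmaps : ∀ b ∈ Finset.range (p ^ 2), (b + s) % p ^ 2 ∈ Finset.range (p ^ 2) :=
      fun b _ => Finset.mem_range.mpr (Nat.mod_lt _ hpos)
    have hinj : Set.InjOn (fun b => (b + s) % p ^ 2) (Finset.range (p ^ 2) : Set ℕ) := by
      intro a ha b hb hab
      rw [Finset.mem_coe, Finset.mem_range] at ha hb
      exact Nat.ModEq.eq_of_lt_of_lt (Nat.ModEq.add_right_cancel' s hab) ha hb
    refine Finset.sum_nbij (fun b => (b + s) % p ^ 2) hmaps hinj
      (Finset.surjOn_of_injOn_of_card_le _ hmaps hinj le_rfl) fun b _ => ?_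
    rw [halfShift_mul_alphaStar b ((b + s) % p ^ 2) ((b + s) / p ^ 2) s hs
      (Nat.mod_add_div _ _).symm, mul_assoc, hf.slash_lift_mul _ _ _ (dvd_zero _)]
  rw [hsum, halfShift_mul_sigmaStar s hs, mul_assoc, hf.slash_lift_mul _ _ _ (dvd_zero _)]
  simp only [halfShift_mul_betaStar]

lemma IsHeckeEigenform.slash_fricke {l k : ℕ} {f : ℍ → ℂ} {ω : ℂ} (hk : 0 < k)
    (hk4 : 4 ∣ (k : ℤ) ^ 2) (hp2 : p ≠ 2) (hkp : IsCoprime (k : ℤ) p)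
    (hf : IsHeckeEigenform p l (k ^ 2) f ω) :
    IsHeckeEigenform p l (k ^ 2) (slash l (fricke k hk) f) ω :=
  ⟨hf.1.slash_fricke hk hk4, slash_ne_zero _ _ hf.2.1,
    heckeT_slash _ hf.2.2 (hf.1.hecke_sum_fricke hk hk4 hp2 hkp)⟩

lemma IsHeckeEigenform.slash_halfShift {l : ℕ} {f : ℍ → ℂ} {ω : ℂ} (hp2 : p ≠ 2)
    (hf : IsHeckeEigenform p l 16 f ω) :
    IsHeckeEigenform p l 16 (slash l halfShift f) ω :=
  ⟨hf.1.slash_halfShift, slash_ne_zero _ _ hf.2.1,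
    heckeT_slash _ hf.2.2 (hf.1.hecke_sum_halfShift hp2)⟩

lemma IsHeckeEigenform.mono {l N N' : ℕ} {f : ℍ → ℂ} {ω : ℂ} (hf : IsHeckeEigenform p l N f ω)
    (h : N ∣ N') : IsHeckeEigenform p l N' f ω :=
  ⟨hf.1.mono h, hf.2⟩

lemma IsHeckeEigenform.const_mul {l N : ℕ} {f : ℍ → ℂ} {ω : ℂ} (hf : IsHeckeEigenform p l N f ω)
    {k : ℂ} (hk : k ≠ 0) : IsHeckeEigenform p l N (fun z => k * f z) ω := by
  refine ⟨hf.1.const_mul k, fun h => hf.2.1 ?_, fun z => ?_⟩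
  · funext z
    have := congrFun h z
    simpa [hk] using this
  · rw [mul_left_comm, ← hf.2.2 z]
    simp only [heckeT, slash_const_mul, ← Finset.mul_sum]
    ring

end Hecke

lemma rhoZero_mat : rhoZero.mat = glPos 0 (-1) 4 0 (by norm_num) := rfl

lemma rhoHalf_mat : rhoHalf.mat = glPos 1 0 (-2) 1 (by norm_num) := rfl

lemma alphaFour_mat : alphaFour.mat = glPos 4 0 0 1 (by norm_num) := rfl

lemma rhoZero_eq_fricke : rhoZero = fricke 2 two_pos := by
  ext1
  · rw [fricke_mat, rhoZero_mat]
    apply glPos_congr <;> norm_num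
  · funext z
    simp [rhoZero, fricke]

/-- The scalar matrix `-4`, with trivial automorphy factor. -/
def negFour : Gt where
  mat := glPos (-4) 0 0 (-4) (by norm_num)
  phi := fun _ => 1
  holo := mdifferentiable_const
  sq_eq := by
    refine ⟨-1, by simp, fun z => ?_⟩
    rw [glPos_det, glPos_denom, show (-4 : ℝ) * -4 - 0 * 0 = 4 ^ 2 by norm_num,
      Real.sqrt_sq (by norm_num)]
    push_cast
    norm_num

lemma negFour_mat : negFour.mat = glPos (-4) 0 0 (-4) (by norm_num) := rfl

lemma negFour_phi (z : ℍ) : negFour.phi z = 1 := rfl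

lemma slash_negFour (l : ℕ) (f : ℍ → ℂ) : slash l negFour f = f := by
  funext z
  have h1 : negFour.mat • z = z := by
    ext1
    rw [negFour_mat, coe_glPos_smul]
    push_cast
    rw [div_eq_iff (by norm_num)]
    ring
  rw [slash, h1, negFour_phi, one_zpow, one_mul]

/-- Up to a constant, `𝔤` arises from `𝔣` by the Fricke involution of level `4`, the translation by
one half and the Fricke involution of level `16`. -/
lemma exists_gForm_eq (l : ℕ) (f : ℍ → ℂ) : ∃ k : ℂ, k ≠ 0 ∧ gForm l f = fun z =>
    k * slash l (fricke 4 four_pos) (slash l halfShift (slash l (fricke 2 two_pos) f)) z := by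
  -- Both products are `(-16 0; 32 -4)`. The constant between the automorphy factors is immaterial,
  -- since a nonzero multiple of an eigenform is an eigenform.
  have hmat : (rhoHalf * alphaFour * negFour).mat =
      (fricke 2 two_pos * halfShift * fricke 4 four_pos).mat := by
    simp only [Gt.mul_mat, rhoHalf_mat, alphaFour_mat, negFour_mat, fricke_mat, halfShift_mat,
      glPos_mul]
    apply glPos_congr <;> norm_num
  obtain ⟨k, hk, h⟩ := Gt.exists_phi_eq _ _ hmat
  refine ⟨k ^ (-(2 * (l : ℤ) + 1)), zpow_ne_zero _ hk, ?_⟩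
  rw [gForm, ← slash_mul, ← slash_negFour l (slash l (rhoHalf * alphaFour) f), ← slash_mul,
    ← slash_mul, ← slash_mul, ← mul_assoc]
  funext z
  rw [slash, slash, h, hmat, mul_zpow, mul_assoc]

end

end HalfIntegral

theorem lemma3p1 (l : ℕ) (hl : 2 ≤ l) (p : ℕ) [Fact p.Prime] (hp : p ≠ 2)
    (f : UpperHalfPlane → ℂ) (ω : ℂ) (hf : HalfIntegral.IsHeckeEigenform p l 4 f ω) :
    HalfIntegral.IsHeckeEigenform p l 16 (HalfIntegral.gForm l f) ω ∧
      HalfIntegral.IsHeckeEigenform p l 4 (HalfIntegral.hForm l f) ω := by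
  have h2p : IsCoprime ((2 : ℕ) : ℤ) p :=
    Nat.isCoprime_iff_coprime.mpr (Nat.coprime_two_left.mpr ((Fact.out : p.Prime).odd_of_ne_two hp))
  have h4p : IsCoprime ((4 : ℕ) : ℤ) p := by
    have := h2p.pow_left (m := 2)
    norm_num at this ⊢
    exact this
  have hh : HalfIntegral.IsHeckeEigenform p l 4
      (HalfIntegral.slash l (HalfIntegral.fricke 2 two_pos) f) ω :=
    HalfIntegral.IsHeckeEigenform.slash_fricke (k := 2) two_pos (by norm_num) hp h2p hf
  constructor
  · obtain ⟨k, hk, hg⟩ := HalfIntegral.exists_gForm_eq l f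
    rw [hg]
    -- The form is regarded at level 16 because the half translation is shown to normalise the lift
    -- of `Γ₀(16)`.
    have hg16 := HalfIntegral.IsHeckeEigenform.slash_halfShift hp
      (hh.mono (show 4 ∣ 16 by norm_num))
    exact (HalfIntegral.IsHeckeEigenform.slash_fricke (k := 4) four_pos (by norm_num) hp h4p
      hg16).const_mul hk
  · rw [HalfIntegral.hForm, HalfIntegral.rhoZero_eq_fricke]
    exact hh
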